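/- Let $V$ be a finite set and let $\mathbf{G}(V)$ denote the set of simple undirected graphs with vertex set $V$. Let $h : \mathbf{G}(V) \to \{0,1\}$ be a nontrivial monotone-increasing graph property; that is, $h$ is not constant, $h(G) = h(G')$ whenever $G, G' \in \mathbf{G}(V)$ are isomorphic, and $h(G') \le h(G)$ whenever $G'$ is a subgraph of $G$ (every edge of $G'$ is an edge of $G$). Let $D(h)$ be the decision-tree complexity of $h$: the smallest depth of a binary decision tree that computes $h(G)$ for every $G \in \mathbf{G}(V)$, where each inner node of the tree queries whether one pair $\{v,w\}$ of distinct vertices is an edge of $G$, and the depth is the maximal number of queries on a branch. Let $p$ be the largest prime that is less than or equal to $|V|$. Then $$D(h) \ge \frac{p^2}{4}.$$ -/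

import Mathlib

/-- A binary decision tree over Boolean variables indexed by `ι`: a leaf carries the output, and
an inner node queries one variable and continues with the first subtree if the answer is `true`
("yes") and with the second one if it is `false` ("no"). -/
inductive DecisionTree (ι : Type*) where
  | leaf (output : Bool) : DecisionTree ι
  | node (query : ι) (yes no : DecisionTree ι) : DecisionTree ι

namespace DecisionTree

/-- The output of a decision tree on the input `x`. -/
def eval {ι : Type*} : DecisionTree ι → (ι → Bool) → Bool
  | leaf b, _ => b
  | node i yes no, x => if x i = true then yes.eval x else no.eval x

/-- The depth of a decision tree: the largest number of queries on a branch. -/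
def depth {ι : Type*} : DecisionTree ι → ℕ
  | leaf _ => 0
  | node _ yes no => max yes.depth no.depth + 1

/-- Every function that only depends on finitely many variables is computed by some tree. -/
theorem exists_eval_eq {ι : Type*} (l : List ι) :
    ∀ f : (ι → Bool) → Bool, (∀ x y, (∀ i ∈ l, x i = y i) → f x = f y) →
      ∃ t : DecisionTree ι, ∀ x, t.eval x = f x := by
  classical
  induction l with
  | nil =>
    intro f hf
    exact ⟨leaf (f fun _ => false), fun x => hf _ _ (by simp)⟩
  | cons i l ih =>
    intro f hf
    have key : ∀ b, ∃ t : DecisionTree ι, ∀ x, t.eval x = f (Function.update x i b) := by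
      intro b
      refine ih (fun x => f (Function.update x i b)) fun x y hxy => hf _ _ fun j hj => ?_
      by_cases hji : j = i
      · subst hji; simp
      · have hjl : j ∈ l := by simpa [hji] using hj
        simp [hji, hxy j hjl]
    obtain ⟨t1, ht1⟩ := key true
    obtain ⟨t0, ht0⟩ := key false
    refine ⟨node i t1 t0, fun x => ?_⟩
    by_cases hx : x i = true
    · have h : Function.update x i true = x := by rw [← hx, Function.update_eq_self]
      simp [eval, hx, ht1, h]
    · have hx0 : x i = false := by simpa using hx
      have h : Function.update x i false = x := by rw [← hx0, Function.update_eq_self]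
      simp [eval, hx0, ht0, h]

end DecisionTree

/-- The possible edges of a graph on `V`: the two-element subsets of `V`. -/
abbrev EdgeQuery (V : Type*) : Type _ := {e : Sym2 V // ¬ e.IsDiag}

open Classical in
/-- The answers that the graph `G` gives to the edge-queries. -/
noncomputable def edgeAnswers {V : Type*} (G : SimpleGraph V) : EdgeQuery V → Bool :=
  fun e => decide (e.1 ∈ G.edgeSet)

/-- The decision tree `t`, whose queries are edge-queries, correctly computes `h`. -/
def ComputesGraphFunction {V : Type*} (t : DecisionTree (EdgeQuery V))
    (h : SimpleGraph V → Bool) : Prop :=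
  ∀ G : SimpleGraph V, t.eval (edgeAnswers G) = h G

/-- On a finite vertex set every function on graphs is computed by some decision tree, so the
minimum in `decisionTreeComplexity` is over a nonempty set. -/
theorem exists_computesGraphFunction {V : Type*} [Finite V] (h : SimpleGraph V → Bool) :
    ∃ t : DecisionTree (EdgeQuery V), ComputesGraphFunction t h := by
  classical
  have := Fintype.ofFinite V
  obtain ⟨t, ht⟩ := DecisionTree.exists_eval_eq (Finset.univ : Finset (EdgeQuery V)).toList
    (fun x => h (SimpleGraph.fromEdgeSet {e | ∃ he : ¬ e.IsDiag, x ⟨e, he⟩ = true}))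
    (fun x y hxy => by
      have : x = y := funext fun i => hxy i (by simp)
      rw [this])
  refine ⟨t, fun G => ?_⟩
  rw [ht]
  congr 1
  ext v w
  simp only [edgeAnswers, SimpleGraph.fromEdgeSet_adj, Set.mem_ofPred_eq, decide_eq_true_eq,
    SimpleGraph.mem_edgeSet, Sym2.mk_isDiag_iff, exists_prop]
  exact ⟨fun hvw => hvw.1.2, fun hvw => ⟨⟨hvw.ne, hvw⟩, hvw.ne⟩⟩

/-- The decision-tree complexity `D(h)`: the smallest depth of a decision tree computing `h`. -/
noncomputable def decisionTreeComplexity {V : Type*} (h : SimpleGraph V → Bool) : ℕ :=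
  sInf {d : ℕ | ∃ t : DecisionTree (EdgeQuery V), ComputesGraphFunction t h ∧ t.depth = d}

/-- A graph property over `V`: a `{0, 1}`-valued function on the graphs with vertex set `V` that
takes the same value on isomorphic graphs. -/
def IsGraphProperty {V : Type*} (h : SimpleGraph V → Bool) : Prop :=
  ∀ G G' : SimpleGraph V, Nonempty (G ≃g G') → h G = h G'

/-- `h` is nontrivial: it is not constant. -/
def IsNontrivialGraphFunction {V : Type*} (h : SimpleGraph V → Bool) : Prop :=
  ∃ G G' : SimpleGraph V, h G ≠ h G'

/-!
The proof is topological. A monotone function `f` on the subsets of a finite set of variables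
defines the simplicial complex of the sets at which `f` is false. If a decision tree computes `f`
without ever having to query all variables, then this complex is void or acyclic over every field
(`isAcyclic_falseSets_of_depth_lt`): the branches of the tree assemble it from cones. Here and
below a complex is replaced by its barycentric subdivision, the order complex of its poset of
nonempty faces. The cardinality colours the vertices of the subdivision, and symmetries of `f`
preserve colours, so that a face mapped to itself is fixed pointwise and orientations need no care.

Smith's theorem (`IsAcyclicComplex.fixed`) says that the fixed subcomplex of a symmetry of prime
order `p` is again acyclic over `ZMod p`. The Lefschetz number of any symmetry of an acyclic
complex vanishes (`IsAcyclicComplex.exists_fixed_vertex`), which forces a fixed vertex besides the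
empty face. Together they show that a pair of symmetries, one of prime order and the other
normalizing the group it generates, has a common invariant nonempty set of variables at which `f`
is false (`exists_fixed_falseSet`).

For graph properties the variables are the potential edges. If the number of vertices is a prime
`p`, the affine group of `ZMod p` is generated by such a pair and is transitive on the edges, so
there is no proper invariant set of edges and all `p * (p - 1) / 2 ≥ p ^ 2 / 4` edges have to be
queried. With more than `p` vertices, one vertex can be made isolated or dominating as long as the
property stays nontrivial, and induction applies. When this is impossible, every remaining graph
with an isolated vertex has the value false and every one with a dominating vertex the value true.
The vertices are then split into halves `A`, complete, and `B`, empty. A nonempty set of edges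
between `A` and `B` that is invariant under a cyclic rotation of `B` makes some vertex of `A`
dominating, so all edges between `A` and `B` have to be queried, and there are at least `p ^ 2 / 4`
of them.
-/

/-! ### Chains of balanced complexes -/

section Chains

variable {W : Type*} (k : Type*) [Field k]

/-- A balanced complex on the vertex type `W`: a family `K` of finite sets (the faces), closed
under passing to subsets, together with a colouring `r` of the vertices that is injective on each
face. The empty set may be a face. -/
structure IsBalancedComplex (r : W → ℕ) (K : Set (Finset W)) : Prop where
  mem_of_subset : ∀ {c d : Finset W}, c ∈ K → d ⊆ c → d ∈ K
  injOn : ∀ {c : Finset W}, c ∈ K → Set.InjOn r c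

/-- The augmented chains of `K` with coefficients in `k`, as functions on all finite sets that
vanish outside `K`. -/
def chainsOn (K : Set (Finset W)) : Submodule k (Finset W → k) where
  carrier := {a | ∀ c, c ∉ K → a c = 0}
  add_mem' ha hb c hc := by simp [ha c hc, hb c hc]
  zero_mem' _ _ := rfl
  smul_mem' t a ha c hc := by simp [ha c hc]

variable {k}

theorem mem_of_mem_chainsOn {K : Set (Finset W)} {a : Finset W → k} (ha : a ∈ chainsOn k K)
    {c : Finset W} (hc : a c ≠ 0) : c ∈ K := by
  by_contra h
  exact hc (ha c h)

variable (k)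

/-- The sign with which the vertex `x` enters the face `c`: the parity of its position when the
vertices are listed by increasing colour. -/
def colourSign (r : W → ℕ) (x : W) (c : Finset W) : k := (-1) ^ (c.filter (r · < r x)).card

variable {k}

theorem colourSign_mul_self (r : W → ℕ) (x : W) (c : Finset W) :
    colourSign k r x c * colourSign k r x c = 1 := by
  rw [colourSign, ← pow_add, Even.neg_one_pow ⟨_, rfl⟩]

theorem colour_ne_of_mem {r : W → ℕ} {K : Set (Finset W)} (hK : IsBalancedComplex r K)
    {c : Finset W} (hc : c ∈ K) {x y : W} (hx : x ∈ c) (hy : y ∈ c) (hxy : x ≠ y) : r x ≠ r y :=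
  fun h => hxy (hK.injOn hc (by simpa using hx) (by simpa using hy) h)

variable [DecidableEq W]

theorem colourSign_insert (r : W → ℕ) {x y : W} {c : Finset W} (hy : y ∉ c) :
    colourSign k r x (insert y c) = (if r y < r x then -1 else 1) * colourSign k r x c := by
  unfold colourSign
  rw [Finset.filter_insert]
  split_ifs with h
  · rw [Finset.card_insert_of_notMem (by simp [hy]), pow_succ, mul_comm]
  · simp

/-- Inserting two vertices of different colours in either order gives opposite signs. -/
theorem colourSign_swap (r : W → ℕ) {x y : W} {c : Finset W} (hx : x ∉ c) (hy : y ∉ c)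
    (hxy : r x ≠ r y) :
    colourSign k r x c * colourSign k r y (insert x c) =
      -(colourSign k r y c * colourSign k r x (insert y c)) := by
  rw [colourSign_insert r hx, colourSign_insert r hy]
  rcases lt_or_gt_of_ne hxy with h | h
  · rw [if_pos h, if_neg h.le.not_gt]; ring
  · rw [if_pos h, if_neg (lt_asymm h)]; ring

variable (k) [Fintype W]

/-- The simplicial boundary map of the chains, including the augmentation. -/
def colourBoundary (r : W → ℕ) : (Finset W → k) →ₗ[k] (Finset W → k) where
  toFun a c := ∑ x ∈ cᶜ, colourSign k r x c * a (insert x c)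
  map_add' a b := by
    funext c
    simp [mul_add, Finset.sum_add_distrib]
  map_smul' t a := by
    funext c
    simp only [Pi.smul_apply, smul_eq_mul, RingHom.id_apply, Finset.mul_sum]
    exact Finset.sum_congr rfl fun x _ => by ring

/-- `K` is acyclic over `k`: its reduced (augmented) homology with coefficients in `k` vanishes. -/
def IsAcyclicComplex (r : W → ℕ) (K : Set (Finset W)) : Prop :=
  ∀ a ∈ chainsOn k K, colourBoundary k r a = 0 → ∃ b ∈ chainsOn k K, colourBoundary k r b = a

variable {k}

theorem colourBoundary_apply (r : W → ℕ) (a : Finset W → k) (c : Finset W) :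
    colourBoundary k r a c = ∑ x ∈ cᶜ, colourSign k r x c * a (insert x c) := rfl

theorem colourBoundary_mem_chainsOn {r : W → ℕ} {K : Set (Finset W)}
    (hK : IsBalancedComplex r K) {a : Finset W → k} (ha : a ∈ chainsOn k K) :
    colourBoundary k r a ∈ chainsOn k K := by
  intro c hc
  rw [colourBoundary_apply]
  refine Finset.sum_eq_zero fun x _ => ?_
  rw [ha _ fun h => hc (hK.mem_of_subset h (Finset.subset_insert x c)), mul_zero]

theorem colourBoundary_colourBoundary {r : W → ℕ} {K : Set (Finset W)}
    (hK : IsBalancedComplex r K) {a : Finset W → k} (ha : a ∈ chainsOn k K) :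
    colourBoundary k r (colourBoundary k r a) = 0 := by
  funext c
  simp only [colourBoundary_apply, Finset.mul_sum, Pi.zero_apply]
  rw [Finset.sum_sigma']
  refine Finset.sum_involution (fun q _ => ⟨q.2, q.1⟩) ?_ ?_ ?_ ?_
  · rintro ⟨x, y⟩ h
    simp only [Finset.mem_sigma, Finset.mem_compl, Finset.mem_insert, not_or] at h
    obtain ⟨hx, hyx, hy⟩ := h
    simp only [Finset.insert_comm x y c]
    by_cases hz : a (insert y (insert x c)) = 0
    · simp [hz]
    · have hne : r x ≠ r y := colour_ne_of_mem hK (mem_of_mem_chainsOn ha hz) (by simp) (by simp)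
        (Ne.symm hyx)
      rw [← mul_assoc, ← mul_assoc, colourSign_swap r hx hy hne]
      ring
  · rintro ⟨x, y⟩ h _ heq
    simp only [Finset.mem_sigma, Finset.mem_compl, Finset.mem_insert, not_or] at h
    simp only [Sigma.mk.injEq, heq_eq_eq] at heq
    exact h.2.1 heq.1
  · rintro ⟨x, y⟩ h
    simp only [Finset.mem_sigma, Finset.mem_compl, Finset.mem_insert, not_or] at h ⊢
    exact ⟨h.2.2, Ne.symm h.2.1, h.1⟩
  · rintro ⟨x, y⟩ h
    rfl

/-- The chain `b` coned off from the vertex `v`. -/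
def coneOff (r : W → ℕ) (v : W) (b : Finset W → k) : Finset W → k :=
  fun c => if v ∈ c then colourSign k r v (c.erase v) * b (c.erase v) else 0

/-- The part of the chain `a` lying over the link of `v`. -/
def linkPart (r : W → ℕ) (v : W) (a : Finset W → k) : Finset W → k :=
  fun c => if v ∈ c then 0 else colourSign k r v c * a (insert v c)

/-- Coning off from `v` is a contraction of the star of `v`. -/
theorem colourBoundary_coneOff {r : W → ℕ} {v : W} {b : Finset W → k}
    (hb : ∀ c, b c ≠ 0 → Set.InjOn r (insert v c : Finset W)) :
    colourBoundary k r (coneOff r v b) + coneOff r v (colourBoundary k r b) = b := by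
  funext c
  rw [Pi.add_apply]
  by_cases hv : v ∈ c
  · obtain ⟨c, hvc, rfl⟩ : ∃ c' : Finset W, v ∉ c' ∧ c = insert v c' :=
      ⟨c.erase v, Finset.notMem_erase v c, (Finset.insert_erase hv).symm⟩
    have hcompl : cᶜ = insert v (insert v c)ᶜ := by
      ext x; by_cases hx : x = v <;> simp [hx, hvc]
    simp only [coneOff, Finset.mem_insert_self, if_true, Finset.erase_insert hvc]
    rw [colourBoundary_apply, colourBoundary_apply, hcompl,
      Finset.sum_insert (by simp), mul_add, ← mul_assoc, colourSign_mul_self, one_mul,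
      add_left_comm, Finset.mul_sum, ← Finset.sum_add_distrib, Finset.sum_eq_zero, add_zero]
    intro x hx
    simp only [Finset.mem_compl, Finset.mem_insert, not_or] at hx
    have hvx : v ∉ insert x c := by simp [Ne.symm hx.1, hvc]
    simp only [coneOff, Finset.insert_comm x v c, Finset.mem_insert_self, if_true,
      Finset.erase_insert hvx]
    by_cases hz : b (insert x c) = 0
    · simp [hz]
    · have hne : r v ≠ r x := fun h => hx.1 (hb _ hz (by simp) (by simp) h).symm
      have := colourSign_swap (k := k) r hx.2 hvc hne.symm
      have h1 := colourSign_mul_self (k := k) r x (insert v c)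
      have h2 : colourSign k r x (insert v c) * colourSign k r v (insert x c)
          = -(colourSign k r v c * colourSign k r x c) := by
        have h3 := colourSign_mul_self (k := k) r x c
        linear_combination (colourSign k r x c * colourSign k r x (insert v c)) * this
          - (colourSign k r x (insert v c) * colourSign k r v (insert x c)) * h3
          - (colourSign k r x c * colourSign k r v c) * h1
      linear_combination b (insert x c) * h2
  · have h0 : coneOff r v (colourBoundary k r b) c = 0 := by simp [coneOff, hv]
    rw [h0, add_zero, colourBoundary_apply, Finset.sum_eq_single v]
    · simp only [coneOff, Finset.mem_insert_self, if_true, Finset.erase_insert hv]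
      rw [← mul_assoc, colourSign_mul_self, one_mul]
    · intro x _ hx
      simp [coneOff, hv, Ne.symm hx]
    · simp [hv]

theorem colourBoundary_linkPart {r : W → ℕ} {K : Set (Finset W)} (hK : IsBalancedComplex r K)
    {v : W} {a : Finset W → k} (ha : a ∈ chainsOn k K) (hcycle : colourBoundary k r a = 0) :
    colourBoundary k r (linkPart r v a) = 0 := by
  funext c
  rw [colourBoundary_apply, Pi.zero_apply]
  by_cases hv : v ∈ c
  · exact Finset.sum_eq_zero fun x _ => by simp [linkPart, hv]
  · have hcompl : cᶜ = insert v (insert v c)ᶜ := by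
      ext x; by_cases hx : x = v <;> simp [hx, hv]
    have h0 := congrFun hcycle (insert v c)
    rw [colourBoundary_apply, Pi.zero_apply] at h0
    rw [hcompl, Finset.sum_insert (by simp)]
    have h1 : linkPart r v a (insert v c) = 0 := by simp [linkPart]
    rw [h1, mul_zero, zero_add, ← neg_eq_zero]
    rw [← mul_zero (colourSign k r v c), ← h0, Finset.mul_sum, ← Finset.sum_neg_distrib]
    refine Finset.sum_congr rfl fun x hx => ?_
    simp only [Finset.mem_compl, Finset.mem_insert, not_or] at hx
    have hvx : v ∉ insert x c := by simp [Ne.symm hx.1, hv]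
    simp only [linkPart, hvx, if_false, Finset.insert_comm x v c]
    by_cases hz : a (insert v (insert x c)) = 0
    · simp [hz]
    · have hne : r x ≠ r v := colour_ne_of_mem hK (mem_of_mem_chainsOn ha hz) (by simp) (by simp)
        hx.1
      have := colourSign_swap (k := k) r hx.2 hv hne
      linear_combination -a (insert v (insert x c)) * this

/-- A cone is acyclic. -/
theorem IsAcyclicComplex.of_cone {r : W → ℕ} {K : Set (Finset W)} (hK : IsBalancedComplex r K)
    (v : W) (hv : ∀ c ∈ K, insert v c ∈ K) : IsAcyclicComplex k r K := by
  intro a ha hcycle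
  refine ⟨coneOff r v a, fun c hc => ?_, ?_⟩
  · unfold coneOff
    split_ifs with h
    · rw [ha, mul_zero]
      intro h'
      exact hc (by simpa [Finset.insert_erase h] using hv _ h')
    · rfl
  · have := colourBoundary_coneOff (r := r) (v := v) (b := a)
      fun c hc => hK.injOn (hv c (mem_of_mem_chainsOn ha hc))
    have h0 : coneOff r v (0 : Finset W → k) = 0 := by funext c; simp [coneOff]
    rwa [hcycle, h0, add_zero] at this

/-- If the deletion and the link of a vertex are acyclic, then so is the whole complex. -/
theorem IsAcyclicComplex.of_deletion_link {r : W → ℕ} {K : Set (Finset W)}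
    (hK : IsBalancedComplex r K) (v : W)
    (hdel : IsAcyclicComplex k r {c | c ∈ K ∧ v ∉ c})
    (hlink : IsAcyclicComplex k r {c | v ∉ c ∧ insert v c ∈ K}) : IsAcyclicComplex k r K := by
  intro a ha hcycle
  obtain ⟨b₁, hb₁, hab₁⟩ := hlink (linkPart r v a) (by
    intro c hc
    simp only [Set.mem_ofPred_eq, not_and] at hc
    unfold linkPart
    split_ifs with h
    · rfl
    · rw [ha _ (hc h), mul_zero]) (colourBoundary_linkPart hK ha hcycle)
  have hcone := colourBoundary_coneOff (r := r) (v := v) (b := b₁)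
    fun c hc => hK.injOn (mem_of_mem_chainsOn hb₁ hc).2
  have hcone' := colourBoundary_coneOff (r := r) (v := v) (b := linkPart r v a) (by
    intro c hc
    refine hK.injOn (mem_of_mem_chainsOn ha fun h => hc ?_)
    simp [linkPart, h])
  rw [colourBoundary_linkPart hK ha hcycle] at hcone'
  have h0 : coneOff r v (0 : Finset W → k) = 0 := by funext c; simp [coneOff]
  rw [h0, add_zero] at hcone'
  rw [hab₁] at hcone
  have hd : colourBoundary k r (coneOff r v b₁) = b₁ - coneOff r v (linkPart r v a) :=
    eq_sub_of_add_eq hcone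
  -- Subtracting a boundary moves the cycle `a` off the vertex `v`.
  obtain ⟨b₀, hb₀, hab₀⟩ := hdel (a + colourBoundary k r (coneOff r v b₁)) (by
    intro c hc
    rw [hd]
    simp only [Pi.add_apply, Pi.sub_apply]
    by_cases hv : v ∈ c
    · have h1 : b₁ c = 0 := hb₁ _ fun h => h.1 hv
      have h2 : coneOff r v (linkPart r v a) c = a c := by
        simp only [coneOff, linkPart, hv, if_true, Finset.notMem_erase, if_false,
          Finset.insert_erase hv]
        rw [← mul_assoc, colourSign_mul_self, one_mul]
      rw [h1, h2]; ring
    · have hcK : c ∉ K := fun h => hc ⟨h, hv⟩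
      have h1 : b₁ c = 0 := hb₁ _ fun h =>
        hcK (hK.mem_of_subset h.2 (Finset.subset_insert v c))
      simp [h1, ha c hcK, coneOff, hv]) (by
    rw [hd, map_add, map_sub, hcycle, hab₁, hcone', sub_self, add_zero])
  refine ⟨b₀ - coneOff r v b₁, Submodule.sub_mem _ (fun c hc => hb₀ c fun h => hc h.1) ?_, ?_⟩
  · intro c hc
    unfold coneOff
    split_ifs with h
    · rw [hb₁, mul_zero]
      intro h'
      exact hc (by simpa [Finset.insert_erase h] using h'.2)
    · rfl
  · rw [map_sub, hab₀, add_sub_cancel_right]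

end Chains

/-! ### Colour-preserving permutations -/

section Permutations

variable {W k : Type*} [Field k]

variable (k) in
/-- The action of a permutation of the vertices on functions on finite sets of vertices, by
pulling back. -/
def pullChain (g : Equiv.Perm W) : (Finset W → k) →ₗ[k] (Finset W → k) :=
  LinearMap.funLeft k k g.finsetCongr

theorem pullChain_apply (g : Equiv.Perm W) (a : Finset W → k) (c : Finset W) :
    pullChain k g a c = a (g.finsetCongr c) := rfl

theorem pullChain_pow_apply (g : Equiv.Perm W) (j : ℕ) (a : Finset W → k) (c : Finset W) :
    (pullChain k g ^ j) a c = a (g.finsetCongr^[j] c) := by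
  induction j generalizing c with
  | zero => simp
  | succ j ih =>
    rw [pow_succ', Module.End.mul_apply, pullChain_apply, ih, Function.iterate_succ_apply]

theorem pullChain_mem_chainsOn {g : Equiv.Perm W} {K : Set (Finset W)}
    (hg : ∀ c, g.finsetCongr c ∈ K ↔ c ∈ K) {a : Finset W → k} (ha : a ∈ chainsOn k K) :
    pullChain k g a ∈ chainsOn k K :=
  fun c hc => ha _ fun h => hc ((hg c).1 h)

theorem colourSign_finsetCongr {r : W → ℕ} {g : Equiv.Perm W} (hr : ∀ x, r (g x) = r x)
    (x : W) (c : Finset W) : colourSign k r (g x) (g.finsetCongr c) = colourSign k r x c := by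
  unfold colourSign
  rw [Equiv.finsetCongr_apply, Finset.filter_map, Finset.card_map]
  simp [hr]

/-- A colour-preserving permutation that maps a face to itself fixes each of its vertices. -/
theorem apply_eq_of_finsetCongr_eq {r : W → ℕ} {K : Set (Finset W)}
    (hK : IsBalancedComplex r K) {g : Equiv.Perm W} (hr : ∀ x, r (g x) = r x) {c : Finset W}
    (hc : c ∈ K) (hgc : g.finsetCongr c = c) {x : W} (hx : x ∈ c) : g x = x := by
  have h : g x ∈ c := by
    rw [← hgc]
    simpa using hx
  exact hK.injOn hc (by simpa using h) (by simpa using hx) (hr x)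

theorem finsetCongr_eq_of_forall {g : Equiv.Perm W} {c : Finset W} (h : ∀ x ∈ c, g x = x) :
    g.finsetCongr c = c := by
  refine Finset.eq_of_subset_of_card_le (fun y hy => ?_) (by simp)
  simp only [Equiv.finsetCongr_apply, Finset.mem_map_equiv] at hy
  have := h _ hy
  rw [Equiv.apply_symm_apply] at this
  rwa [this]

/-! ### Smith theory -/

/-- A permutation of prime order `p` has a weight function that sums to one over each orbit of
length `p`, and vanishes at the fixed points. -/
theorem exists_orbit_weight {X : Type*} (t : Equiv.Perm X) {p : ℕ} (hp : p.Prime)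
    (ht : t ^ p = 1) : ∃ φ : X → k, (∀ x, t x = x → φ x = 0) ∧
      ∀ x, t x ≠ x → ∑ j ∈ Finset.range p, φ (t^[j] x) = 1 := by
  classical
  let s := Equiv.Perm.SameCycle.setoid t
  let rep : X → X := fun x => (Quotient.mk s x).out
  have hrep : ∀ x, t.SameCycle (rep x) x := fun x => Quotient.mk_out (s := s) x
  have hinv : ∀ x y, t.SameCycle x y → rep x = rep y := fun x y h =>
    congrArg Quotient.out (Quotient.sound (s := s) h)
  refine ⟨fun x => if t x ≠ x ∧ rep x = x then 1 else 0, fun x hx => by simp [hx], fun x hx => ?_⟩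
  have hper : Function.IsPeriodicPt t p x := by
    rw [Function.IsPeriodicPt, Function.IsFixedPt, ← Equiv.Perm.coe_pow, ht]; rfl
  have hmin : Function.minimalPeriod t x = p := by
    rcases (Nat.dvd_prime hp).1 hper.minimalPeriod_dvd with h | h
    · exact absurd (Function.minimalPeriod_eq_one_iff_isFixedPt.1 h) hx
    · exact h
  have hne : ∀ j, t (t^[j] x) ≠ t^[j] x := by
    intro j h
    rw [← Function.iterate_succ_apply' t j x, Function.iterate_succ_apply] at h
    exact hx ((t.injective.iterate j) h)
  have hrepj : ∀ j, rep (t^[j] x) = rep x := fun j =>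
    (hinv _ _ ⟨j, by simp [← Equiv.Perm.coe_pow]⟩).symm
  obtain ⟨j₀, hj₀, hx₀⟩ : ∃ j < p, t^[j] x = rep x := by
    obtain ⟨i, hi⟩ := (hrep x).symm
    have hp0 : (0 : ℤ) < p := by exact_mod_cast hp.pos
    refine ⟨(i % p).toNat, ?_, ?_⟩
    · have := Int.emod_lt_of_pos i hp0
      have := Int.emod_nonneg i hp0.ne'
      omega
    · rw [← hi, ← Equiv.Perm.coe_pow, ← zpow_natCast, Int.toNat_of_nonneg
        (Int.emod_nonneg i hp0.ne')]
      conv_rhs => rw [← Int.emod_add_mul_ediv i p, zpow_add, zpow_mul, zpow_natCast, ht, one_zpow,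
        mul_one]
  rw [Finset.sum_eq_single j₀]
  · dsimp only
    rw [if_pos ⟨hne j₀, by rw [hrepj, hx₀]⟩]
  · intro j hj hjj
    dsimp only
    rw [if_neg]
    rintro ⟨-, h⟩
    rw [hrepj, ← hx₀] at h
    refine hjj (Function.iterate_injOn_Iio_minimalPeriod (f := t) (x := x) ?_ ?_ h.symm)
    · simpa [hmin] using hj
    · simpa [hmin] using hj₀
  · intro h
    simp [hj₀] at h

/-- The norm operator `1 + T + ⋯ + T ^ (p - 1)` of the action of `g`. -/
noncomputable def pullNorm (k : Type*) [Field k] {W : Type*} (g : Equiv.Perm W) (p : ℕ) :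
    (Finset W → k) →ₗ[k] (Finset W → k) :=
  ∑ j ∈ Finset.range p, pullChain k g ^ j

theorem pullNorm_apply (g : Equiv.Perm W) (p : ℕ) (a : Finset W → k) (c : Finset W) :
    pullNorm k g p a c = ∑ j ∈ Finset.range p, a (g.finsetCongr^[j] c) := by
  simp [pullNorm, pullChain_pow_apply]

theorem finsetCongr_pow {g : Equiv.Perm W} {p : ℕ} (hg : g ^ p = 1) :
    (g.finsetCongr : Equiv.Perm (Finset W)) ^ p = 1 := by
  have key : ∀ (j : ℕ) (c : Finset W), ((g.finsetCongr : Equiv.Perm (Finset W)) ^ j) c =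
      (g ^ j).finsetCongr c := by
    intro j
    induction j with
    | zero => intro c; ext x; simp [show (1 : Equiv.Perm W).symm = 1 from rfl]
    | succ j ih =>
      intro c
      rw [pow_succ', Equiv.Perm.mul_apply, ih]
      simp only [Equiv.finsetCongr_apply, Finset.map_map, pow_succ' g]
      rfl
  ext1 c
  rw [key, hg]
  ext x
  simp [show (1 : Equiv.Perm W).symm = 1 from rfl]

theorem exists_of_pullChain_eq {g : Equiv.Perm W} {p : ℕ} (hp : p.Prime) (hg : g ^ p = 1)
    {K : Set (Finset W)} {a : Finset W → k} (ha : a ∈ chainsOn k K)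
    (h : (pullChain k g - 1) a = 0) :
    ∃ b ∈ chainsOn k K, ∃ e ∈ chainsOn k {c | c ∈ K ∧ g.finsetCongr c = c},
      a = pullNorm k g p b + e := by
  classical
  obtain ⟨φ, hφ0, hφ⟩ := exists_orbit_weight (k := k) (g.finsetCongr : Equiv.Perm (Finset W)) hp
    (finsetCongr_pow hg)
  have hinv : ∀ (j : ℕ) (c : Finset W), a (g.finsetCongr^[j] c) = a c := by
    intro j c
    rw [← pullChain_pow_apply g j a]
    have h1 : pullChain k g a = a := by simpa [sub_eq_zero] using h
    induction j with
    | zero => simp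
    | succ j ih => rw [pow_succ, Module.End.mul_apply, h1, ih]
  refine ⟨fun c => φ c * a c, fun c hc => by simp [ha c hc],
    fun c => if g.finsetCongr c = c then a c else 0, fun c hc => ?_, ?_⟩
  · dsimp only
    split_ifs with h'
    · exact ha c fun h => hc ⟨h, h'⟩
    · rfl
  · funext c
    rw [Pi.add_apply, pullNorm_apply]
    simp only [hinv]
    rw [← Finset.sum_mul]
    split_ifs with h'
    · have : ∀ j, g.finsetCongr^[j] c = c := fun j => Function.iterate_fixed h' j
      simp [this, hφ0 c h']
    · rw [hφ c h', one_mul, add_zero]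

theorem exists_of_pullNorm_eq_zero {g : Equiv.Perm W} {p : ℕ} (hp : p.Prime) (hg : g ^ p = 1)
    {K : Set (Finset W)} (hK : ∀ c, g.finsetCongr c ∈ K ↔ c ∈ K) {a : Finset W → k}
    (ha : a ∈ chainsOn k K) (h : pullNorm k g p a = 0) :
    ∃ b ∈ chainsOn k K, ∃ e ∈ chainsOn k {c | c ∈ K ∧ g.finsetCongr c = c},
      a = (pullChain k g - 1) b + e := by
  classical
  obtain ⟨φ, hφ0, hφ⟩ := exists_orbit_weight (k := k) (g.finsetCongr : Equiv.Perm (Finset W)) hp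
    (finsetCongr_pow hg)
  have hper : ∀ c, g.finsetCongr^[p] c = c := fun c => by
    rw [← Equiv.Perm.coe_pow, finsetCongr_pow hg]; rfl
  set T := pullChain k g with hT
  have hTK : ∀ (j : ℕ) (b), b ∈ chainsOn k K → (T ^ j) b ∈ chainsOn k K := by
    intro j
    induction j with
    | zero => intro b hb; simpa using hb
    | succ j ih =>
      intro b hb
      rw [pow_succ, Module.End.mul_apply]
      exact ih _ (pullChain_mem_chainsOn hK hb)
  -- `u j` is `φ · T ^ (p - j) a`, and the chains `T ^ j (u j)` add up to the free part of `a`.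
  let u : ℕ → Finset W → k := fun j c => φ c * (T ^ (p - j)) a c
  have hu : ∀ j, u j ∈ chainsOn k K := fun j c hc => by
    simp only [u]; rw [hTK _ _ ha c hc, mul_zero]
  refine ⟨∑ j ∈ Finset.range p, (∑ i ∈ Finset.range j, T ^ i) (u j),
    Submodule.sum_mem _ fun j _ => ?_,
    fun c => if g.finsetCongr c = c then a c else 0, fun c hc => ?_, ?_⟩
  · rw [LinearMap.sum_apply]
    exact Submodule.sum_mem _ fun i _ => hTK _ _ (hu j)
  · dsimp only
    split_ifs with h'
    · exact ha c fun h => hc ⟨h, h'⟩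
    · rfl
  · rw [map_sum]
    have h1 : ∀ j, (T - 1) ((∑ i ∈ Finset.range j, T ^ i) (u j)) = (T ^ j) (u j) - u j := by
      intro j
      rw [← Module.End.mul_apply, mul_geom_sum]
      simp
    simp only [h1]
    have h2 : ∑ j ∈ Finset.range p, u j = 0 := by
      funext c
      have h3 := congrFun h c
      simp only [pullNorm_apply, Pi.zero_apply] at h3
      simp only [Finset.sum_apply, u, ← Finset.mul_sum, Pi.zero_apply]
      rw [mul_eq_zero]; right
      rw [← h3]
      simp only [hT, pullChain_pow_apply]
      -- The sums over `p - j` and over `j` agree because the exponents only matter modulo `p`.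
      have h4 := Finset.sum_range_reflect (fun j => a (g.finsetCongr^[j + 1] c)) p
      have h5 := Finset.sum_range_succ (fun j => a (g.finsetCongr^[j] c)) p
      rw [Finset.sum_range_succ', hper, Function.iterate_zero_apply] at h5
      rw [← add_right_cancel h5, ← h4]
      refine Finset.sum_congr rfl fun j hj => ?_
      have : p - j = p - 1 - j + 1 := by have := Finset.mem_range.1 hj; omega
      rw [this]
    rw [Finset.sum_sub_distrib, h2, sub_zero]
    funext c
    simp only [Pi.add_apply, Finset.sum_apply]
    have h6 : ∀ j ∈ Finset.range p, (T ^ j) (u j) c = φ (g.finsetCongr^[j] c) * a c := by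
      intro j hj
      rw [pullChain_pow_apply]
      simp only [u]
      rw [pullChain_pow_apply, ← Function.iterate_add_apply,
        Nat.sub_add_cancel (Finset.mem_range.1 hj).le, hper]
    rw [Finset.sum_congr rfl h6, ← Finset.sum_mul]
    split_ifs with h'
    · have : ∀ j, g.finsetCongr^[j] c = c := fun j => Function.iterate_fixed h' j
      simp [this, hφ0 c h']
    · rw [hφ c h', one_mul, add_zero]

variable [DecidableEq W] [Fintype W]

theorem colourBoundary_pullChain {r : W → ℕ} {g : Equiv.Perm W} (hr : ∀ x, r (g x) = r x)
    (a : Finset W → k) :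
    colourBoundary k r (pullChain k g a) = pullChain k g (colourBoundary k r a) := by
  funext c
  rw [colourBoundary_apply, pullChain_apply, colourBoundary_apply]
  refine Finset.sum_equiv g (fun x => by simp) fun x _ => ?_
  rw [colourSign_finsetCongr hr, pullChain_apply]
  congr 2
  simp [Finset.map_insert]

/-- In an acyclic complex a cycle whose faces have at least `n` vertices bounds a chain whose faces
have at least `n + 1` vertices. -/
theorem IsAcyclicComplex.exists_truncated {r : W → ℕ} {K : Set (Finset W)}
    (hK : IsAcyclicComplex k r K) {n : ℕ} {z : Finset W → k}
    (hz : z ∈ chainsOn k {c | c ∈ K ∧ n ≤ c.card}) (hcycle : colourBoundary k r z = 0) :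
    ∃ w ∈ chainsOn k {c | c ∈ K ∧ n + 1 ≤ c.card}, colourBoundary k r w = z := by
  obtain ⟨w, hw, hwz⟩ := hK z (fun c hc => hz c fun h => hc h.1) hcycle
  refine ⟨fun c => if n + 1 ≤ c.card then w c else 0, fun c hc => ?_, ?_⟩
  · dsimp only
    split_ifs with h
    · exact hw c fun h' => hc ⟨h', h⟩
    · rfl
  · funext c
    rw [colourBoundary_apply]
    have h1 : ∀ x ∈ cᶜ, (insert x c).card = c.card + 1 := fun x hx =>
      Finset.card_insert_of_notMem (by simpa using hx)
    by_cases hn : n ≤ c.card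
    · rw [← hwz, colourBoundary_apply]
      exact Finset.sum_congr rfl fun x hx => by rw [h1 x hx, if_pos (by omega)]
    · rw [hz c fun h => hn h.2]
      exact Finset.sum_eq_zero fun x hx => by rw [h1 x hx, if_neg (by omega), mul_zero]

/-- The inductive step of Smith theory, for a pair of operators `ρ`, `ρ'` that plays the role of
the pair `T - 1`, `1 + T + ⋯ + T ^ (p - 1)`, in either order. It is the connecting homomorphism of
the short exact sequence `0 → ρ' C ⊕ A → C → ρ C → 0`, where `C` are the chains of `K` and `A` those
of the fixed subcomplex `F`. -/
theorem smith_step {r : W → ℕ} {K F : Set (Finset W)} (hKb : IsBalancedComplex r K)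
    (hK : IsAcyclicComplex k r K) (hFb : IsBalancedComplex r F) (hFK : F ⊆ K)
    {ρ ρ' : (Finset W → k) →ₗ[k] (Finset W → k)}
    (hρ : ∀ a, colourBoundary k r (ρ a) = ρ (colourBoundary k r a))
    (hρ' : ∀ a, colourBoundary k r (ρ' a) = ρ' (colourBoundary k r a))
    (hρρ' : ∀ a, ρ (ρ' a) = 0) (hρF : ∀ e ∈ chainsOn k F, ρ e = 0)
    (hρ'F : ∀ a, ∀ c ∈ F, ρ' a c = 0)
    (hρ'K : ∀ n, ∀ a ∈ chainsOn k {c | c ∈ K ∧ n ≤ c.card},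
      ρ' a ∈ chainsOn k {c | c ∈ K ∧ n ≤ c.card})
    (hker : ∀ n, ∀ a ∈ chainsOn k {c | c ∈ K ∧ n ≤ c.card}, ρ a = 0 →
      ∃ b ∈ chainsOn k {c | c ∈ K ∧ n ≤ c.card}, ∃ e ∈ chainsOn k F, a = ρ' b + e)
    {n : ℕ}
    (hn : ∀ b ∈ chainsOn k {c | c ∈ K ∧ n + 1 ≤ c.card}, colourBoundary k r (ρ b) = 0 →
      ∃ u ∈ chainsOn k {c | c ∈ K ∧ n + 2 ≤ c.card}, colourBoundary k r (ρ u) = ρ b)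
    {b e : Finset W → k} (hb : b ∈ chainsOn k {c | c ∈ K ∧ n ≤ c.card})
    (he : e ∈ chainsOn k {c | c ∈ F ∧ n ≤ c.card})
    (hcycle : colourBoundary k r (ρ' b + e) = 0) :
    ∃ u ∈ chainsOn k {c | c ∈ K ∧ n + 1 ≤ c.card}, ∃ e' ∈ chainsOn k F,
      colourBoundary k r (ρ' u) = ρ' b ∧ colourBoundary k r e' = e := by
  have heF : e ∈ chainsOn k F := fun c hc => he c fun h => hc h.1
  obtain ⟨w, hw, hwz⟩ := hK.exists_truncated (z := ρ' b + e) (n := n)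
    (Submodule.add_mem _ (hρ'K n b hb) fun c hc => he c fun h => hc ⟨hFK h.1, h.2⟩) hcycle
  obtain ⟨u, hu, huw⟩ := hn w hw (by rw [hρ, hwz, map_add, hρρ', hρF e heF, add_zero])
  have huK : u ∈ chainsOn k K := fun c hc => hu c fun h => hc h.1
  obtain ⟨c, hc, e', he', hce⟩ := hker (n + 1) (w - colourBoundary k r u)
    (Submodule.sub_mem _ hw fun c hc => by
      rw [colourBoundary_apply]
      refine Finset.sum_eq_zero fun x hx => ?_
      rw [hu, mul_zero]
      rintro ⟨h1, h2⟩
      rw [Finset.card_insert_of_notMem (by simpa using hx)] at h2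
      exact hc ⟨hKb.mem_of_subset h1 (Finset.subset_insert x c), by omega⟩)
    (by rw [map_sub, ← hρ, huw, sub_self])
  have hsum : colourBoundary k r (ρ' c) + colourBoundary k r e' = ρ' b + e := by
    rw [← map_add, ← hce, map_sub, colourBoundary_colourBoundary hKb huK, sub_zero, hwz]
  -- The sum of `ρ' C` and the chains of the fixed subcomplex is direct.
  have hdiff : colourBoundary k r e' - e = ρ' (b - colourBoundary k r c) := by
    rw [map_sub, ← hρ']
    linear_combination hsum
  have hzero : colourBoundary k r e' - e = 0 := by
    funext d
    by_cases hd : d ∈ F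
    · rw [hdiff, hρ'F _ d hd]; rfl
    · exact (Submodule.sub_mem _ (colourBoundary_mem_chainsOn hFb he') heF) d hd
  refine ⟨c, hc, e', he', ?_, sub_eq_zero.1 hzero⟩
  rw [sub_eq_zero.1 hzero] at hsum
  exact add_right_cancel hsum

/-- **Smith's theorem** for balanced complexes: a colour-preserving permutation of prime order `p`
of a complex that is acyclic in characteristic `p` has an acyclic fixed subcomplex. -/
theorem IsAcyclicComplex.fixed {r : W → ℕ} {K : Set (Finset W)} (hKb : IsBalancedComplex r K)
    (hK : IsAcyclicComplex k r K) {p : ℕ} [CharP k p] (hp : p.Prime) {g : Equiv.Perm W}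
    (hg : g ^ p = 1) (hr : ∀ x, r (g x) = r x) (hgK : ∀ c, g.finsetCongr c ∈ K ↔ c ∈ K) :
    IsAcyclicComplex k r {c | c ∈ K ∧ g.finsetCongr c = c} := by
  set F : Set (Finset W) := {c | c ∈ K ∧ g.finsetCongr c = c} with hF
  have hFb : IsBalancedComplex r F :=
    { mem_of_subset := fun {c d} hc hdc => ⟨hKb.mem_of_subset hc.1 hdc, finsetCongr_eq_of_forall
        fun x hx => apply_eq_of_finsetCongr_eq hKb hr hc.1 hc.2 (hdc hx)⟩
      injOn := fun {c} hc => hKb.injOn hc.1 }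
  have hFK : F ⊆ K := fun c hc => hc.1
  set T := pullChain k g with hT
  have hTp : T ^ p = 1 := by
    refine LinearMap.ext fun a => funext fun c => ?_
    rw [pullChain_pow_apply, ← Equiv.Perm.coe_pow, finsetCongr_pow hg]
    rfl
  have hgn : ∀ n, ∀ c : Finset W, g.finsetCongr c ∈ {c | c ∈ K ∧ n ≤ c.card} ↔
      c ∈ {c | c ∈ K ∧ n ≤ c.card} := fun n c => by simpa using fun _ => hgK c
  have hTn : ∀ (n j : ℕ) (a), a ∈ chainsOn k {c | c ∈ K ∧ n ≤ c.card} →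
      (T ^ j) a ∈ chainsOn k {c | c ∈ K ∧ n ≤ c.card} := by
    intro n j
    induction j with
    | zero => intro b hb; simpa using hb
    | succ j ih =>
      intro b hb
      rw [pow_succ, Module.End.mul_apply]
      exact ih _ (pullChain_mem_chainsOn (hgn n) hb)
  have hTd : ∀ (j : ℕ) (a), colourBoundary k r ((T ^ j) a) = (T ^ j) (colourBoundary k r a) := by
    intro j
    induction j with
    | zero => intro a; simp
    | succ j ih =>
      intro a
      rw [pow_succ, Module.End.mul_apply, Module.End.mul_apply, ih, colourBoundary_pullChain hr]
  have hδd : ∀ a, colourBoundary k r ((T - 1) a) = (T - 1) (colourBoundary k r a) := fun a => by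
    simpa using hTd 1 a
  have hσd : ∀ a, colourBoundary k r (pullNorm k g p a) =
      pullNorm k g p (colourBoundary k r a) := fun a => by
    simp only [pullNorm, LinearMap.sum_apply, map_sum]
    exact Finset.sum_congr rfl fun j _ => hTd j a
  have hδσ : ∀ a, (T - 1) (pullNorm k g p a) = 0 := fun a => by
    rw [← Module.End.mul_apply, pullNorm, mul_geom_sum, hTp, sub_self, LinearMap.zero_apply]
  have hσδ : ∀ a, pullNorm k g p ((T - 1) a) = 0 := fun a => by
    rw [← Module.End.mul_apply, pullNorm, geom_sum_mul, hTp, sub_self, LinearMap.zero_apply]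
  have hδF' : ∀ a, ∀ c ∈ F, (T - 1) a c = 0 := fun a c hc => by
    simp [hT, pullChain_apply, hc.2]
  have hσF' : ∀ a, ∀ c ∈ F, pullNorm k g p a c = 0 := fun a c hc => by
    have : ∀ j, g.finsetCongr^[j] c = c := fun j => Function.iterate_fixed hc.2 j
    simp [pullNorm_apply, this]
  have hfix : ∀ (a : Finset W → k), a ∈ chainsOn k F → T a = a := fun a ha => by
    funext c
    rw [hT, pullChain_apply]
    by_cases hc : g.finsetCongr c = c
    · rw [hc]
    · rw [ha c fun h => hc h.2, ha _ fun h => hc (g.finsetCongr.injective h.2)]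
  have hδF : ∀ e ∈ chainsOn k F, (T - 1) e = 0 := fun e he => by simp [hfix e he]
  have hσF : ∀ e ∈ chainsOn k F, pullNorm k g p e = 0 := fun e he => by
    funext c
    by_cases hc : c ∈ F
    · exact hσF' e c hc
    · rw [pullNorm_apply]
      refine Finset.sum_eq_zero fun j _ => ?_
      rw [← pullChain_pow_apply g j e]
      have : ∀ j, (pullChain k g ^ j) e = e := fun j => by
        induction j with
        | zero => simp
        | succ j ih => rw [pow_succ, Module.End.mul_apply, ← hT, hfix e he, hT, ih]
      rw [this, he c hc]
  have hδn : ∀ n, ∀ a ∈ chainsOn k {c | c ∈ K ∧ n ≤ c.card},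
      (T - 1) a ∈ chainsOn k {c | c ∈ K ∧ n ≤ c.card} := fun n a ha => by
    simpa using Submodule.sub_mem _ (hTn n 1 a ha) ha
  have hσn : ∀ n, ∀ a ∈ chainsOn k {c | c ∈ K ∧ n ≤ c.card},
      pullNorm k g p a ∈ chainsOn k {c | c ∈ K ∧ n ≤ c.card} := fun n a ha => by
    rw [pullNorm, LinearMap.sum_apply]
    exact Submodule.sum_mem _ fun j _ => hTn n j a ha
  have hsub : ∀ n, chainsOn k {c | c ∈ {c | c ∈ K ∧ n ≤ c.card} ∧ g.finsetCongr c = c} ≤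
      chainsOn k F := fun n a ha c hc => ha c fun h => hc ⟨h.1.1, h.2⟩
  have hkerδ : ∀ n, ∀ a ∈ chainsOn k {c | c ∈ K ∧ n ≤ c.card}, (T - 1) a = 0 →
      ∃ b ∈ chainsOn k {c | c ∈ K ∧ n ≤ c.card}, ∃ e ∈ chainsOn k F,
        a = pullNorm k g p b + e := fun n a ha h => by
    obtain ⟨b, hb, e, he, hab⟩ := exists_of_pullChain_eq hp hg ha h
    exact ⟨b, hb, e, hsub n he, hab⟩
  have hkerσ : ∀ n, ∀ a ∈ chainsOn k {c | c ∈ K ∧ n ≤ c.card}, pullNorm k g p a = 0 →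
      ∃ b ∈ chainsOn k {c | c ∈ K ∧ n ≤ c.card}, ∃ e ∈ chainsOn k F,
        a = (T - 1) b + e := fun n a ha h => by
    obtain ⟨b, hb, e, he, hab⟩ := exists_of_pullNorm_eq_zero hp hg (hgn n) ha h
    exact ⟨b, hb, e, hsub n he, hab⟩
  have main : ∀ m n, n + m = Fintype.card W + 1 →
      (∀ b ∈ chainsOn k {c | c ∈ K ∧ n ≤ c.card}, colourBoundary k r ((T - 1) b) = 0 →
        ∃ u ∈ chainsOn k {c | c ∈ K ∧ n + 1 ≤ c.card},
          colourBoundary k r ((T - 1) u) = (T - 1) b) ∧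
      (∀ b ∈ chainsOn k {c | c ∈ K ∧ n ≤ c.card}, colourBoundary k r (pullNorm k g p b) = 0 →
        ∃ u ∈ chainsOn k {c | c ∈ K ∧ n + 1 ≤ c.card},
          colourBoundary k r (pullNorm k g p u) = pullNorm k g p b) := by
    intro m
    induction m with
    | zero =>
      intro n hn
      have h0 : ∀ b ∈ chainsOn k {c | c ∈ K ∧ n ≤ c.card}, b = 0 := fun b hb => by
        funext c
        refine hb c fun h => ?_
        have := h.2
        have := Finset.card_le_univ c
        omega
      exact ⟨fun b hb _ => ⟨0, Submodule.zero_mem _, by simp [h0 b hb]⟩,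
        fun b hb _ => ⟨0, Submodule.zero_mem _, by simp [h0 b hb]⟩⟩
    | succ m ih =>
      intro n hn
      obtain ⟨ihδ, ihσ⟩ := ih (n + 1) (by omega)
      constructor
      · intro b hb hcycle
        obtain ⟨u, hu, -, -, h, -⟩ := smith_step hKb hK hFb hFK hσd hδd hσδ hσF hδF' hδn hkerσ
          ihσ hb (Submodule.zero_mem _) (by rwa [add_zero])
        exact ⟨u, hu, h⟩
      · intro b hb hcycle
        obtain ⟨u, hu, -, -, h, -⟩ := smith_step hKb hK hFb hFK hδd hσd hδσ hδF hσF' hσn hkerδ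
          ihδ hb (Submodule.zero_mem _) (by rwa [add_zero])
        exact ⟨u, hu, h⟩
  intro e he hcycle
  obtain ⟨-, -, e', he', -, h⟩ := smith_step (n := 0) (b := 0) (e := e) hKb hK hFb hFK hδd hσd hδσ
    hδF hσF' hσn hkerδ (main (Fintype.card W) 1 (by omega)).1 (Submodule.zero_mem _)
    (fun c hc => he c fun h => hc ⟨h, Nat.zero_le _⟩) (by rwa [map_zero, zero_add])
  exact ⟨e', he', h⟩

end Permutations

/-! ### A Lefschetz fixed point theorem -/

section Lefschetz

/-- The supertrace of an endomorphism of an exact complex vanishes. The complex is the image of the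
projection `P`, its differential is `D`, and `T` is the endomorphism multiplied by the sign of the
grading, so that it anticommutes with `D`. -/
theorem trace_eq_zero_of_exact {k V : Type*} [Field k] [AddCommGroup V] [Module k V]
    {D P T : Module.End k V} (hDD : D * D = 0) (hDP : D * P = D)
    (hPD : P * D = D) (hPP : P * P = P) (hTP : T * P = P * T) (hTD : D * T = -(T * D))
    (hex : ∀ a, P a = a → D a = 0 → ∃ b, D b = a) : LinearMap.trace k V (T * P) = 0 := by
  obtain ⟨s, hs⟩ : ∃ s : Module.End k V, D * s * D = D := by
    obtain ⟨g, hg⟩ := LinearMap.exists_rightInverse_of_surjective D.rangeRestrict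
      (LinearMap.range_rangeRestrict D)
    obtain ⟨s, hs⟩ := LinearMap.exists_extend g
    refine ⟨s, LinearMap.ext fun a => ?_⟩
    have h1 : s (D a) = g (D.rangeRestrict a) := LinearMap.congr_fun hs (D.rangeRestrict a)
    have h2 := LinearMap.congr_fun hg (D.rangeRestrict a)
    rw [Module.End.mul_apply, Module.End.mul_apply, h1]
    exact congrArg Subtype.val h2
  have hN : D * s * (P - P * s * D) = P - P * s * D := by
    refine LinearMap.ext fun a => ?_
    obtain ⟨b, hb⟩ := hex ((P - P * s * D) a)
      (by rw [← Module.End.mul_apply, mul_sub, ← mul_assoc, ← mul_assoc, hPP])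
      (by rw [← Module.End.mul_apply, mul_sub, ← mul_assoc, ← mul_assoc, hDP, hs, sub_self,
        LinearMap.zero_apply])
    rw [Module.End.mul_apply, ← hb, ← Module.End.mul_apply, hs]
  have h1 : LinearMap.trace k V (T * (P * s * D)) = -LinearMap.trace k V (T * D * s) := by
    rw [← mul_assoc, LinearMap.trace_mul_comm, ← map_neg]
    congr 1
    rw [← mul_assoc, hTD, neg_mul, mul_assoc T, ← mul_assoc D, hDP, mul_assoc]
  have h2 : LinearMap.trace k V (T * D * s * P) = LinearMap.trace k V (T * D * s) := by
    rw [LinearMap.trace_mul_comm]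
    congr 1
    rw [← mul_assoc, ← mul_assoc, ← hTP, mul_assoc T, hPD]
  have h3 : LinearMap.trace k V (T * D * s * (P * s * D)) = 0 := by
    rw [← mul_assoc, LinearMap.trace_mul_comm, ← map_zero (LinearMap.trace k V)]
    congr 1
    have : D * (T * D * s * (P * s)) = D * T * D * s * (P * s) := by simp only [mul_assoc]
    rw [this, hTD, neg_mul, mul_assoc T, hDD]
    simp
  have h4 : T * P = T * (P * s * D) + (T * D * s * P - T * D * s * (P * s * D)) := by
    rw [← mul_sub, mul_assoc T D s, mul_assoc T (D * s), hN, mul_sub]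
    abel
  rw [h4, map_add, map_sub, h1, h2, h3]
  ring

theorem perm_mem_iff_of_mapsTo {X : Type*} [Finite X] (g : Equiv.Perm X) {S : Set X}
    (h : ∀ x ∈ S, g x ∈ S) (x : X) : g x ∈ S ↔ x ∈ S := by
  refine ⟨fun hx => ?_, h x⟩
  have hpow : ∀ (n : ℕ) (y), y ∈ S → (g ^ n) y ∈ S := by
    intro n
    induction n with
    | zero => intro y hy; simpa using hy
    | succ n ih => intro y hy; rw [pow_succ, Equiv.Perm.mul_apply]; exact ih _ (h y hy)
  have := hpow (orderOf g - 1) _ hx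
  rwa [← Equiv.Perm.mul_apply, ← pow_succ, Nat.sub_add_cancel (orderOf_pos g), pow_orderOf_eq_one]
    at this

variable {W k : Type*} [Field k] [DecidableEq W] [Fintype W]

/-- A colour-preserving permutation of an acyclic complex fixes a vertex: otherwise the empty face
is the only one mapped to itself, and the Lefschetz number is one. -/
theorem IsAcyclicComplex.exists_fixed_vertex {r : W → ℕ} {K : Set (Finset W)}
    (hKb : IsBalancedComplex r K) (hK : IsAcyclicComplex k r K) (hempty : ∅ ∈ K)
    {g : Equiv.Perm W} (hr : ∀ x, r (g x) = r x) (hgK : ∀ c ∈ K, g.finsetCongr c ∈ K) :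
    ∃ x, {x} ∈ K ∧ g x = x := by
  classical
  by_contra! hfix
  have hgK' := perm_mem_iff_of_mapsTo g.finsetCongr hgK
  set P : Module.End k (Finset W → k) := LinearMap.mulLeft k fun c => if c ∈ K then 1 else 0
    with hP
  set ε : Module.End k (Finset W → k) := LinearMap.mulLeft k fun c => (-1) ^ c.card with hε
  set D : Module.End k (Finset W → k) := colourBoundary k r * P with hD
  have hPa : ∀ a c, P a c = (if c ∈ K then 1 else 0) * a c := fun a c => rfl
  have hεa : ∀ a c, ε a c = (-1) ^ c.card * a c := fun a c => rfl
  have hPmem : ∀ a, P a ∈ chainsOn k K := fun a c hc => by rw [hPa, if_neg hc, zero_mul]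
  have hPid : ∀ a ∈ chainsOn k K, P a = a := fun a ha => by
    funext c
    rw [hPa]
    split_ifs with h
    · rw [one_mul]
    · rw [ha c h, mul_zero]
  have hDmem : ∀ a, D a ∈ chainsOn k K := fun a => colourBoundary_mem_chainsOn hKb (hPmem a)
  have hPP : P * P = P := LinearMap.ext fun a => hPid _ (hPmem a)
  have hPD : P * D = D := LinearMap.ext fun a => hPid _ (hDmem a)
  have hDP : D * P = D := by rw [hD, mul_assoc, hPP]
  have hDD : D * D = 0 := by
    refine LinearMap.ext fun a => ?_
    rw [hD, mul_assoc, ← hD, hPD, hD]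
    exact colourBoundary_colourBoundary hKb (hPmem a)
  have hTP : ε * pullChain k g * P = P * (ε * pullChain k g) := by
    refine LinearMap.ext fun a => funext fun c => ?_
    simp only [Module.End.mul_apply, hPa, hεa, pullChain_apply, hgK']
    ring
  have hTD : D * (ε * pullChain k g) = -(ε * pullChain k g * D) := by
    set d : Module.End k (Finset W → k) := colourBoundary k r with hd
    have h1 : d * ε = -(ε * d) := by
      refine LinearMap.ext fun a => funext fun c => ?_
      simp only [Module.End.mul_apply, LinearMap.neg_apply, Pi.neg_apply, hεa, hd,
        colourBoundary_apply, Finset.mul_sum, ← Finset.sum_neg_distrib]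
      refine Finset.sum_congr rfl fun x hx => ?_
      rw [Finset.card_insert_of_notMem (by simpa using hx)]
      ring
    have h2 : d * pullChain k g = pullChain k g * d :=
      LinearMap.ext fun a => colourBoundary_pullChain hr a
    refine LinearMap.ext fun a => ?_
    calc d (P ((ε * pullChain k g) a)) = d (ε (pullChain k g (P a))) :=
          congrArg d (LinearMap.congr_fun hTP a).symm
      _ = -ε (d (pullChain k g (P a))) := LinearMap.congr_fun h1 _
      _ = -ε (pullChain k g (d (P a))) := by rw [← Module.End.mul_apply d, h2]; rfl
  have htr := trace_eq_zero_of_exact hDD hDP hPD hPP hTP hTD fun a hPa' hDa => by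
    have ha : a ∈ chainsOn k K := hPa' ▸ hPmem a
    obtain ⟨b, hb, hba⟩ := hK a ha (by rw [hD, Module.End.mul_apply, hPa'] at hDa; exact hDa)
    exact ⟨b, by rw [hD, Module.End.mul_apply, hPid b hb, hba]⟩
  rw [LinearMap.trace_eq_matrix_trace k (Pi.basisFun k (Finset W)), Matrix.trace,
    Finset.sum_eq_single ∅] at htr
  · simp [Module.End.mul_apply, hPa, hεa, pullChain_apply, hempty] at htr
  · intro c _ hc
    simp only [Matrix.diag_apply, LinearMap.toMatrix_apply, Pi.basisFun_apply, Pi.basisFun_repr,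
      Module.End.mul_apply, hPa, hεa, pullChain_apply]
    by_cases hcK : g.finsetCongr c ∈ K
    · rw [Pi.single_eq_of_ne, mul_zero, mul_zero]
      intro h
      obtain ⟨x, hx⟩ := Finset.nonempty_iff_ne_empty.2 hc
      rw [h] at hcK
      exact hfix x (hKb.mem_of_subset hcK (by simpa using hx))
        (apply_eq_of_finsetCongr_eq hKb hr hcK h hx)
    · rw [if_neg hcK, zero_mul, mul_zero]
  · simp

end Lefschetz

/-! ### Order complexes -/

section OrderComplex

variable {ι k : Type*} [Field k]

/-- The order complex of a family `Q` of finite sets: its faces are the finite chains in `Q`. It is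
balanced, with the cardinality as colour. -/
def orderComplex (Q : Set (Finset ι)) : Set (Finset (Finset ι)) :=
  {c | (c : Set (Finset ι)) ⊆ Q ∧ IsChain (· ⊆ ·) (c : Set (Finset ι))}

theorem isBalancedComplex_orderComplex (Q : Set (Finset ι)) :
    IsBalancedComplex Finset.card (orderComplex Q) where
  mem_of_subset hc hdc :=
    ⟨(Finset.coe_subset.2 hdc).trans hc.1, hc.2.mono (Finset.coe_subset.2 hdc)⟩
  injOn {c} hc x hx y hy hxy := by
    rcases hc.2.total hx hy with h | h
    · exact Finset.eq_of_subset_of_card_le h hxy.ge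
    · exact (Finset.eq_of_subset_of_card_le h hxy.le).symm

theorem insert_mem_orderComplex [DecidableEq (Finset ι)] {Q : Set (Finset ι)}
    {c : Finset (Finset ι)} {x : Finset ι} :
    insert x c ∈ orderComplex Q ↔
      x ∈ Q ∧ c ∈ orderComplex Q ∧ ∀ y ∈ c, y ⊆ x ∨ x ⊆ y := by
  constructor
  · rintro ⟨h1, h2⟩
    rw [Finset.coe_insert] at h1 h2
    refine ⟨h1 (Set.mem_insert _ _), ⟨(Set.subset_insert _ _).trans h1,
      h2.mono (Set.subset_insert _ _)⟩, fun y hy => ?_⟩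
    exact h2.total (Set.mem_insert_of_mem _ hy) (Set.mem_insert _ _)
  · rintro ⟨h1, h2, h3⟩
    refine ⟨?_, ?_⟩
    · rw [Finset.coe_insert]
      exact Set.insert_subset h1 h2.1
    · rw [Finset.coe_insert]
      exact h2.2.insert fun y hy _ => (h3 y hy).symm

/-- The sets strictly above `B` and contained in `C` at which `f` is false: the nonempty faces, each
joined with `B`, of the complex that the monotone function `f` defines on `C \ B`. -/
def falseSets (f : Finset ι → Bool) (B C : Finset ι) : Set (Finset ι) :=
  {Y | B ⊂ Y ∧ Y ⊆ C ∧ f Y = false}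

theorem eq_false_of_subset {f : Finset ι → Bool} (hf : Monotone f) {Y Z : Finset ι} (h : Z ⊆ Y)
    (hY : f Y = false) : f Z = false := by
  have := hf h
  rw [hY] at this
  exact Bool.eq_false_of_le_false this

/-- A permutation of the variables that preserves `f`, `B` and `C` preserves the order complex of
`falseSets f B C`. -/
theorem finsetCongr_mem_orderComplex {f : Finset ι → Bool} {B C : Finset ι} {g : Equiv.Perm ι}
    (hf : ∀ Y, f (g.finsetCongr Y) = f Y) (hB : g.finsetCongr B = B) (hC : g.finsetCongr C = C)
    {c : Finset (Finset ι)} (hc : c ∈ orderComplex (falseSets f B C)) :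
    Equiv.finsetCongr g.finsetCongr c ∈ orderComplex (falseSets f B C) := by
  have hsub : ∀ Y Z : Finset ι, Y ⊆ Z → g.finsetCongr Y ⊆ g.finsetCongr Z := fun Y Z h => by
    simpa using h
  constructor
  · intro Z hZ
    simp only [Equiv.finsetCongr_apply, Finset.coe_map, Set.mem_image] at hZ
    obtain ⟨Y, hY, rfl⟩ := hZ
    obtain ⟨h1, h2, h3⟩ := hc.1 hY
    refine ⟨?_, ?_, ?_⟩
    · have : g.finsetCongr B ⊂ g.finsetCongr Y := by simpa using h1
      rwa [hB] at this
    · have : g.finsetCongr Y ⊆ g.finsetCongr C := hsub _ _ h2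
      rwa [hC] at this
    · exact (hf Y).trans h3
  · simp only [Equiv.finsetCongr_apply, Finset.coe_map]
    rintro _ ⟨Y, hY, rfl⟩ _ ⟨Z, hZ, rfl⟩ _
    exact (hc.2.total hY hZ).imp (hsub Y Z) (hsub Z Y)

variable [Fintype ι] [DecidableEq ι]

theorem isAcyclic_orderComplex_of_comparable {Q : Set (Finset ι)} {x : Finset ι} (hx : x ∈ Q)
    (h : ∀ y ∈ Q, y ⊆ x ∨ x ⊆ y) : IsAcyclicComplex k Finset.card (orderComplex Q) :=
  .of_cone (isBalancedComplex_orderComplex Q) x fun _ hc =>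
    insert_mem_orderComplex.2 ⟨hx, hc, fun y hy => h y (hc.1 hy)⟩

/-- An element may be added to a family with acyclic order complex if the elements comparable to it
have acyclic order complex. -/
theorem isAcyclic_orderComplex_insert {Q : Set (Finset ι)} {x : Finset ι} (hx : x ∉ Q)
    (hQ : IsAcyclicComplex k Finset.card (orderComplex Q))
    (hlink : IsAcyclicComplex k Finset.card (orderComplex {y | y ∈ Q ∧ (y ⊆ x ∨ x ⊆ y)})) :
    IsAcyclicComplex k Finset.card (orderComplex (insert x Q)) := by
  refine .of_deletion_link (isBalancedComplex_orderComplex _) x ?_ ?_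
  · convert hQ using 1
    ext c
    constructor
    · rintro ⟨⟨h1, h2⟩, h3⟩
      exact ⟨fun y hy => (h1 hy).resolve_left fun h => h3 (h ▸ hy), h2⟩
    · rintro ⟨h1, h2⟩
      exact ⟨⟨h1.trans (Set.subset_insert _ _), h2⟩, fun h => hx (h1 h)⟩
  · convert hlink using 1
    ext c
    constructor
    · rintro ⟨h3, h4⟩
      obtain ⟨-, ⟨h1, h2⟩, h5⟩ := insert_mem_orderComplex.1 h4
      exact ⟨fun y hy => ⟨(h1 hy).resolve_left fun h => h3 (h ▸ hy), h5 y hy⟩, h2⟩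
    · rintro ⟨h1, h2⟩
      refine ⟨fun h => hx (h1 h).1, insert_mem_orderComplex.2 ⟨Set.mem_insert _ _,
        ⟨fun y hy => Set.mem_insert_of_mem _ (h1 hy).1, h2⟩, fun y hy => (h1 hy).2⟩⟩

/-! ### Decision trees and acyclicity -/

theorem isAcyclic_falseSets_of_erase_insert {f : Finset ι → Bool} (hf : Monotone f)
    {B C : Finset ι} (hBC : B ⊆ C) {e : ι} (heC : e ∈ C) (heB : e ∉ B)
    (hdel : IsAcyclicComplex k Finset.card (orderComplex (falseSets f B (C.erase e))))
    (hlink : f (insert e B) = true ∨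
      IsAcyclicComplex k Finset.card (orderComplex (falseSets f (insert e B) C))) :
    IsAcyclicComplex k Finset.card (orderComplex (falseSets f B C)) := by
  by_cases htrue : f (insert e B) = true
  · convert hdel using 2
    ext Y
    refine ⟨fun ⟨h1, h2, h3⟩ => ⟨h1, Finset.subset_erase.2 ⟨h2, fun he => ?_⟩, h3⟩,
      fun ⟨h1, h2, h3⟩ => ⟨h1, h2.trans (Finset.erase_subset _ _), h3⟩⟩
    have := eq_false_of_subset hf (Finset.insert_subset he h1.subset) h3
    simp [this] at htrue
  have hfalse : f (insert e B) = false := by simpa using htrue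
  have hlink := hlink.resolve_left htrue
  have heY : ∀ Y ∈ falseSets f B (C.erase e), e ∉ Y := fun Y hY he =>
    Finset.notMem_erase e C (hY.2.1 he)
  have heZ : ∀ Z ∈ falseSets f (insert e B) C, e ∈ Z := fun Z hZ =>
    hZ.1.subset (Finset.mem_insert_self _ _)
  -- The sets properly containing `insert e B` are added by decreasing cardinality.
  have key : ∀ U : Finset (Finset ι), (∀ Z ∈ U, Z ∈ falseSets f (insert e B) C) →
      IsAcyclicComplex k Finset.card
        (orderComplex (falseSets f B (C.erase e) ∪ (U : Set (Finset ι)))) := by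
    intro U
    refine Finset.induction_on_min_value Finset.card U (fun _ => by simpa using hdel) ?_
    · intro x U hxU hmin ih hU
      have hx := hU x (Finset.mem_insert_self _ _)
      rw [Finset.coe_insert, Set.union_insert]
      refine isAcyclic_orderComplex_insert ?_ (ih fun Z hZ => hU Z (Finset.mem_insert_of_mem hZ)) ?_
      · rintro (h | h)
        · exact heY x h (heZ x hx)
        · exact hxU h
      · refine isAcyclic_orderComplex_of_comparable (x := x.erase e)
          ⟨Or.inl ⟨?_, Finset.erase_subset_erase e hx.2.1,
            eq_false_of_subset hf (Finset.erase_subset e x) hx.2.2⟩,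
            Or.inl (Finset.erase_subset e x)⟩ ?_
        · refine Finset.ssubset_iff_subset_ne.2 ⟨Finset.subset_erase.2
            ⟨(Finset.subset_insert e B).trans hx.1.subset, heB⟩, fun h => hx.1.ne ?_⟩
          rw [h, Finset.insert_erase (heZ x hx)]
        · rintro y ⟨hy | hy, hxy | hxy⟩
          · exact Or.inl (Finset.subset_erase.2 ⟨hxy, heY y hy⟩)
          · exact absurd (hxy (heZ x hx)) (heY y hy)
          · exact absurd (Finset.eq_of_subset_of_card_le hxy (hmin y hy)) fun h => hxU (h ▸ hy)
          · exact Or.inr ((Finset.erase_subset e x).trans hxy)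
  classical
  have hall := key (Finset.univ.filter (· ∈ falseSets f (insert e B) C)) (by simp)
  have heq : falseSets f B C = insert (insert e B) (falseSets f B (C.erase e) ∪
      ((Finset.univ.filter (· ∈ falseSets f (insert e B) C) : Finset (Finset ι)) :
        Set (Finset ι))) := by
    ext Y
    simp only [Finset.coe_filter, Finset.mem_univ, true_and, Set.mem_insert_iff, Set.mem_union,
      Set.mem_ofPred_eq]
    constructor
    · rintro ⟨h1, h2, h3⟩
      by_cases he : e ∈ Y
      · by_cases hY : Y = insert e B
        · exact Or.inl hY
        · exact Or.inr (Or.inr ⟨Finset.ssubset_iff_subset_ne.2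
            ⟨Finset.insert_subset he h1.subset, Ne.symm hY⟩, h2, h3⟩)
      · exact Or.inr (Or.inl ⟨h1, Finset.subset_erase.2 ⟨h2, he⟩, h3⟩)
    · rintro (rfl | ⟨h1, h2, h3⟩ | ⟨h1, h2, h3⟩)
      · exact ⟨Finset.ssubset_insert heB, Finset.insert_subset heC hBC, hfalse⟩
      · exact ⟨h1, h2.trans (Finset.erase_subset _ _), h3⟩
      · exact ⟨(Finset.ssubset_insert heB).trans h1, h2, h3⟩
  rw [heq]
  refine isAcyclic_orderComplex_insert ?_ hall ?_
  · rintro (h | h)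
    · exact heY _ h (Finset.mem_insert_self _ _)
    · exact (Finset.mem_filter.1 h).2.1.ne rfl
  · convert hlink using 2
    ext Y
    simp only [Finset.coe_filter, Finset.mem_univ, true_and, Set.mem_union, Set.mem_ofPred_eq]
    constructor
    · rintro ⟨h | h, h'⟩
      · rcases h' with h' | h'
        · refine absurd ?_ h.1.not_subset
          intro z hz
          exact (Finset.mem_insert.1 (h' hz)).resolve_left fun hze => heY Y h (hze ▸ hz)
        · exact absurd (h' (Finset.mem_insert_self _ _)) (heY Y h)
      · exact h
    · intro h
      exact ⟨Or.inr h, Or.inr h.1.subset⟩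

/-- If a tree computes `f` between `B` and `C` with fewer than `|C \ B|` queries, then the complex
of `f` is void or acyclic: it is built by gluing cones along the branches of the tree. -/
theorem isAcyclic_falseSets_of_depth_lt {f : Finset ι → Bool} (hf : Monotone f)
    (t : DecisionTree ι) : ∀ B C : Finset ι, B ⊆ C → t.depth < (C \ B).card →
      (∀ Y, B ⊆ Y → Y ⊆ C → t.eval (fun i => decide (i ∈ Y)) = f Y) →
      f B = true ∨ IsAcyclicComplex k Finset.card (orderComplex (falseSets f B C)) := by
  induction t with
  | leaf b =>
    intro B C hBC hdepth heval
    have hBC' : B ⊂ C := by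
      refine Finset.ssubset_iff_subset_ne.2 ⟨hBC, ?_⟩
      rintro rfl
      simp at hdepth
    cases b with
    | true => exact Or.inl (heval B subset_rfl hBC).symm
    | false =>
      exact Or.inr (isAcyclic_orderComplex_of_comparable
        ⟨hBC', subset_rfl, (heval C hBC subset_rfl).symm⟩ fun Y hY => Or.inl hY.2.1)
  | node e yes no ihyes ihno =>
    intro B C hBC hdepth heval
    simp only [DecisionTree.depth] at hdepth
    have hyes : ∀ Y, B ⊆ Y → Y ⊆ C → e ∈ Y → yes.eval (fun i => decide (i ∈ Y)) = f Y := by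
      intro Y h1 h2 he
      rw [← heval Y h1 h2]
      simp [DecisionTree.eval, he]
    have hno : ∀ Y, B ⊆ Y → Y ⊆ C → e ∉ Y → no.eval (fun i => decide (i ∈ Y)) = f Y := by
      intro Y h1 h2 he
      rw [← heval Y h1 h2]
      simp [DecisionTree.eval, he]
    by_cases heB : e ∈ B
    · exact ihyes B C hBC (by omega) fun Y h1 h2 => hyes Y h1 h2 (h1 heB)
    by_cases heC : e ∈ C
    · have hcard : (C \ B).card = ((C \ B).erase e).card + 1 :=
        (Finset.card_erase_add_one (by simp [heB, heC])).symm
      have h1 : C.erase e \ B = (C \ B).erase e := by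
        ext x; simp only [Finset.mem_sdiff, Finset.mem_erase]; tauto
      have h2 : C \ insert e B = (C \ B).erase e := by
        ext x; simp only [Finset.mem_sdiff, Finset.mem_erase, Finset.mem_insert]; tauto
      by_cases hB : f B = true
      · exact Or.inl hB
      refine Or.inr (isAcyclic_falseSets_of_erase_insert hf hBC heC heB
        ((ihno B (C.erase e) (Finset.subset_erase.2 ⟨hBC, heB⟩) (by rw [h1]; omega)
          fun Y h3 h4 => ?_).resolve_left hB)
        (ihyes (insert e B) C (Finset.insert_subset heC hBC) (by rw [h2]; omega)
          fun Y h3 h4 => ?_))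
      · exact hno Y h3 (h4.trans (Finset.erase_subset _ _)) fun he =>
          Finset.notMem_erase e C (h4 he)
      · exact hyes Y ((Finset.subset_insert e B).trans h3) h4 (h3 (Finset.mem_insert_self _ _))
    · exact ihno B C hBC (by omega) fun Y h1 h2 => hno Y h1 h2 fun he => heC (h2 he)

/-- The fixed point theorem for monotone functions that are not evasive: a permutation `τ` of prime
order and a permutation `g` normalizing the group it generates, both preserving the function, have
a common fixed set of variables strictly above `B` at which the function is still false. -/
theorem exists_fixed_falseSet {f : Finset ι → Bool} (hf : Monotone f) {t : DecisionTree ι}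
    {B C : Finset ι} (hBC : B ⊆ C) (hdepth : t.depth < (C \ B).card)
    (heval : ∀ Y, B ⊆ Y → Y ⊆ C → t.eval (fun i => decide (i ∈ Y)) = f Y) (hB : f B = false)
    {p : ℕ} (hp : p.Prime) {τ g : Equiv.Perm ι} (hτ : τ ^ p = 1) {j : ℕ}
    (hτg : τ * g = g * τ ^ j)
    (hfτ : ∀ Y, f (τ.finsetCongr Y) = f Y) (hBτ : τ.finsetCongr B = B)
    (hCτ : τ.finsetCongr C = C)
    (hfg : ∀ Y, f (g.finsetCongr Y) = f Y) (hBg : g.finsetCongr B = B)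
    (hCg : g.finsetCongr C = C) :
    ∃ Y, B ⊂ Y ∧ Y ⊆ C ∧ f Y = false ∧ τ.finsetCongr Y = Y ∧ g.finsetCongr Y = Y := by
  have := Fact.mk hp
  set K := orderComplex (falseSets f B C) with hK
  have hKb : IsBalancedComplex Finset.card K := isBalancedComplex_orderComplex _
  have hKa : IsAcyclicComplex (ZMod p) Finset.card K :=
    (isAcyclic_falseSets_of_depth_lt hf t B C hBC hdepth heval).resolve_left (by simp [hB])
  have hcard : ∀ (σ : Equiv.Perm ι) (Y : Finset ι), (σ.finsetCongr Y).card = Y.card := by simp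
  have hKτ := perm_mem_iff_of_mapsTo (Equiv.finsetCongr τ.finsetCongr) (S := K)
    fun c hc => finsetCongr_mem_orderComplex hfτ hBτ hCτ hc
  have hFa := hKa.fixed hKb hp (finsetCongr_pow hτ) (hcard τ) hKτ
  have hfixτ : ∀ (n : ℕ) (Y : Finset ι), τ.finsetCongr Y = Y →
      (τ ^ n).finsetCongr Y = Y := by
    intro n Y hY
    induction n with
    | zero => ext x; simp [show (1 : Equiv.Perm ι).symm = 1 from rfl]
    | succ n ih =>
      have : (τ ^ (n + 1)).finsetCongr Y = (τ ^ n).finsetCongr (τ.finsetCongr Y) := by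
        simp only [Equiv.finsetCongr_apply, Finset.map_map, pow_succ]
        rfl
      rw [this, hY, ih]
  have hFb : IsBalancedComplex Finset.card
      {c | c ∈ K ∧ Equiv.finsetCongr τ.finsetCongr c = c} :=
    { mem_of_subset := fun {c d} hc hdc => ⟨hKb.mem_of_subset hc.1 hdc, finsetCongr_eq_of_forall
        fun x hx => apply_eq_of_finsetCongr_eq hKb (hcard τ) hc.1 hc.2 (hdc hx)⟩
      injOn := fun {c} hc => hKb.injOn hc.1 }
  obtain ⟨Y, hY, hYg⟩ := hFa.exists_fixed_vertex hFb
    ⟨⟨by simp, by simp⟩, by simp⟩ (g := g.finsetCongr) (hcard g) (by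
      rintro c ⟨hc, hcτ⟩
      refine ⟨finsetCongr_mem_orderComplex hfg hBg hCg hc, finsetCongr_eq_of_forall fun Z hZ => ?_⟩
      simp only [Equiv.finsetCongr_apply g.finsetCongr, Finset.mem_map] at hZ
      obtain ⟨Y, hY, rfl⟩ := hZ
      have h1 : τ.finsetCongr Y = Y := apply_eq_of_finsetCongr_eq hKb (hcard τ) hc hcτ hY
      have h2 : τ.finsetCongr (g.finsetCongr Y) = g.finsetCongr ((τ ^ j).finsetCongr Y) := by
        have : ∀ σ ρ : Equiv.Perm ι, σ.finsetCongr (ρ.finsetCongr Y) = (σ * ρ).finsetCongr Y := by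
          intro σ ρ
          simp only [Equiv.finsetCongr_apply, Finset.map_map]
          rfl
        rw [this, this, hτg]
      exact h2.trans (congrArg _ (hfixτ j Y h1)))
  obtain ⟨h1, h2, h3⟩ := hY.1.1 (by simp : Y ∈ (({Y} : Finset (Finset ι)) : Set (Finset ι)))
  exact ⟨Y, h1, h2, h3,
    apply_eq_of_finsetCongr_eq hKb (hcard τ) hY.1 hY.2 (Finset.mem_singleton_self Y), hYg⟩

end OrderComplex

/-! ### Edge sets of graphs -/

section Graphs

variable {V : Type*}

/-- The graph whose edges are the elements of `Y`. -/
def graphOfEdges (Y : Finset (EdgeQuery V)) : SimpleGraph V :=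
  SimpleGraph.fromEdgeSet (Subtype.val '' (Y : Set (EdgeQuery V)))

theorem edgeSet_graphOfEdges (Y : Finset (EdgeQuery V)) :
    (graphOfEdges Y).edgeSet = Subtype.val '' (Y : Set (EdgeQuery V)) := by
  rw [graphOfEdges, SimpleGraph.edgeSet_fromEdgeSet]
  ext e
  simp only [Set.mem_sdiff, Set.mem_image]
  exact ⟨fun h => h.1, fun h => ⟨h, by obtain ⟨e, -, rfl⟩ := h; exact e.2⟩⟩

theorem mem_edgeSet_graphOfEdges (Y : Finset (EdgeQuery V)) (e : EdgeQuery V) :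
    e.1 ∈ (graphOfEdges Y).edgeSet ↔ e ∈ Y := by
  rw [edgeSet_graphOfEdges]
  exact Subtype.val_injective.mem_set_image

theorem edgeAnswers_graphOfEdges [DecidableEq (EdgeQuery V)] (Y : Finset (EdgeQuery V)) :
    edgeAnswers (graphOfEdges Y) = fun e => decide (e ∈ Y) := by
  funext e
  simp [edgeAnswers, mem_edgeSet_graphOfEdges]

theorem monotone_graphOfEdges : Monotone (graphOfEdges (V := V)) := fun _ _ h =>
  SimpleGraph.fromEdgeSet_mono (Set.image_mono (Finset.coe_subset.2 h))

/-- The action of the permutations of the vertices on the potential edges. -/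
def edgePerm : Equiv.Perm V →* Equiv.Perm (EdgeQuery V) where
  toFun σ :=
    { toFun := fun e => ⟨e.1.map σ, fun h => e.2 ((Sym2.isDiag_map σ.injective).1 h)⟩
      invFun := fun e => ⟨e.1.map σ.symm, fun h => e.2 ((Sym2.isDiag_map σ.symm.injective).1 h)⟩
      left_inv := fun e => Subtype.ext (by simp [Sym2.map_map])
      right_inv := fun e => Subtype.ext (by simp [Sym2.map_map]) }
  map_one' := Equiv.ext fun e => Subtype.ext (by simp)
  map_mul' σ ρ := Equiv.ext fun e => Subtype.ext (by
    simp [Sym2.map_map])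

theorem coe_edgePerm_apply (σ : Equiv.Perm V) (e : EdgeQuery V) :
    (edgePerm σ e).1 = e.1.map σ := rfl

theorem mem_finsetCongr_edgePerm {σ : Equiv.Perm V} {Y : Finset (EdgeQuery V)} {e : EdgeQuery V} :
    edgePerm σ e ∈ (edgePerm σ).finsetCongr Y ↔ e ∈ Y := by
  simp

theorem graphOfEdges_iso (σ : Equiv.Perm V) (Y : Finset (EdgeQuery V)) :
    Nonempty (graphOfEdges Y ≃g graphOfEdges ((edgePerm σ).finsetCongr Y)) := by
  refine ⟨⟨σ, fun {x y} => ?_⟩⟩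
  by_cases hxy : x = y
  · subst hxy; simp
  · let e : EdgeQuery V := ⟨s(x, y), by simpa using hxy⟩
    rw [← SimpleGraph.mem_edgeSet, ← SimpleGraph.mem_edgeSet]
    exact (mem_edgeSet_graphOfEdges _ (edgePerm σ e)).trans
      (mem_finsetCongr_edgePerm.trans (mem_edgeSet_graphOfEdges Y e).symm)

theorem finsetCongr_eq_of_mapsTo {σ : Equiv.Perm V} {Y : Finset (EdgeQuery V)}
    (h : ∀ e ∈ Y, edgePerm σ e ∈ Y) : (edgePerm σ).finsetCongr Y = Y := by
  refine Finset.eq_of_subset_of_card_le (fun e he => ?_) (by simp)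
  simp only [Equiv.finsetCongr_apply, Finset.mem_map] at he
  obtain ⟨e, he, rfl⟩ := he
  exact h e he

theorem edgePerm_mem_of_mem_closure {S : Set (Equiv.Perm V)} {Y : Finset (EdgeQuery V)}
    (h : ∀ σ ∈ S, (edgePerm σ).finsetCongr Y = Y) {σ : Equiv.Perm V}
    (hσ : σ ∈ Subgroup.closure S) {e : EdgeQuery V} (he : e ∈ Y) : edgePerm σ e ∈ Y := by
  suffices ∀ e, edgePerm σ e ∈ Y ↔ e ∈ Y from (this e).2 he
  clear he e
  induction hσ using Subgroup.closure_induction with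
  | mem σ hσ =>
    intro e
    conv_lhs => rw [← h σ hσ]
    exact mem_finsetCongr_edgePerm
  | one => simp
  | mul σ ρ _ _ h1 h2 => intro e; rw [map_mul, Equiv.Perm.mul_apply, h1, h2]
  | inv σ _ h1 =>
    intro e
    rw [← h1, ← Equiv.Perm.mul_apply, ← map_mul, mul_inv_cancel, map_one, Equiv.Perm.one_apply]

theorem exists_mk_eq (e : EdgeQuery V) : ∃ x y, x ≠ y ∧ e.1 = s(x, y) := by
  obtain ⟨e, he⟩ := e
  induction e with
  | _ x y => exact ⟨x, y, by simpa using he, rfl⟩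

theorem apply_mem_of_fixes_compl {R : Finset V} {σ : Equiv.Perm V} (hσ : ∀ x ∉ R, σ x = x) {x : V}
    (hx : x ∈ R) : σ x ∈ R := by
  by_contra h
  exact h (by rwa [σ.injective (hσ _ h)])

variable [DecidableEq V]

/-- The affine group of the field with `p` elements, acting on a set `R` with `p` elements: it is
generated by a translation and a normalizing multiplication, and is doubly transitive. -/
theorem exists_affine_perms {R : Finset V} {p : ℕ} (hp : p.Prime) (hR : R.card = p) :
    ∃ (τ g : Equiv.Perm V) (j : ℕ), τ ^ p = 1 ∧ τ * g = g * τ ^ j ∧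
      (∀ x ∉ R, τ x = x) ∧ (∀ x ∉ R, g x = x) ∧
      ∀ x ∈ R, ∀ y ∈ R, ∀ x' ∈ R, ∀ y' ∈ R, x ≠ y → x' ≠ y' →
        ∃ σ ∈ Subgroup.closure {τ, g}, σ x = x' ∧ σ y = y' := by
  have := Fact.mk hp
  let E : ZMod p ≃ {x // x ∈ R} := Fintype.equivOfCardEq (by simp [ZMod.card, hR])
  obtain ⟨u, hu⟩ := IsCyclic.exists_generator (α := (ZMod p)ˣ)
  let Φ := Equiv.Perm.extendDomainHom E
  have hΦ : ∀ (σ : Equiv.Perm (ZMod p)) (z : ZMod p), Φ σ (E z) = E (σ z) := fun σ z =>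
    Equiv.Perm.extendDomain_apply_image σ E z
  have hΦ' : ∀ (σ : Equiv.Perm (ZMod p)) (x), x ∉ R → Φ σ x = x := fun σ x hx =>
    Equiv.Perm.extendDomain_apply_not_subtype σ E hx
  have hpow : ∀ n : ℕ, (Equiv.addRight (1 : ZMod p)) ^ n = Equiv.addRight (n : ZMod p) := by
    intro n
    induction n with
    | zero => ext1 z; simp
    | succ n ih =>
      ext1 z
      rw [pow_succ, ih, Equiv.Perm.mul_apply]
      simp only [Equiv.coe_addRight, Nat.cast_succ]
      ring
  refine ⟨Φ (Equiv.addRight 1), Φ (Units.mulLeft u), ((u⁻¹ : (ZMod p)ˣ) : ZMod p).val, ?_, ?_,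
    hΦ' _, hΦ' _, ?_⟩
  · rw [← map_pow, hpow, ← map_one Φ]
    congr 1
    ext1 z
    simp
  · rw [← map_pow, ← map_mul, ← map_mul, hpow]
    congr 1
    ext1 z
    have h1 : (u : ZMod p) * ((u⁻¹ : (ZMod p)ˣ) : ZMod p) = 1 := u.mul_inv
    simp only [Equiv.Perm.mul_apply, Units.mulLeft_apply, Equiv.coe_addRight, mul_add]
    rw [ZMod.natCast_zmod_val, h1]
  · intro x hx y hy x' hx' y' hy' hxy hxy'
    obtain ⟨a, ha⟩ := E.surjective ⟨x, hx⟩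
    obtain ⟨b, hb⟩ := E.surjective ⟨y, hy⟩
    obtain ⟨a', ha'⟩ := E.surjective ⟨x', hx'⟩
    obtain ⟨b', hb'⟩ := E.surjective ⟨y', hy'⟩
    obtain rfl : (E a : V) = x := by rw [ha]
    obtain rfl : (E b : V) = y := by rw [hb]
    obtain rfl : (E a' : V) = x' := by rw [ha']
    obtain rfl : (E b' : V) = y' := by rw [hb']
    have hab : a - b ≠ 0 := sub_ne_zero.2 fun h => hxy (by rw [h])
    have hab' : a' - b' ≠ 0 := sub_ne_zero.2 fun h => hxy' (by rw [h])
    -- The affine map is `z ↦ c * z + d`, with `c` the quotient of the differences.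
    obtain ⟨i, hi⟩ := hu (Units.mk0 ((a' - b') / (a - b)) (div_ne_zero hab' hab))
    let d : ZMod p := a' - (a' - b') / (a - b) * a
    have hpowu : ∀ z, (Units.mulLeft u ^ i : Equiv.Perm (ZMod p)) z =
        (a' - b') / (a - b) * z := by
      have h1 : (Units.mulLeft u ^ i : Equiv.Perm (ZMod p)) = Units.mulLeft (u ^ i) :=
        (map_zpow (MulAction.toPermHom (ZMod p)ˣ (ZMod p)) u i).symm
      intro z
      rw [h1, Units.mulLeft_apply]
      simp only at hi
      rw [hi, Units.val_mk0]
    refine ⟨Φ (Equiv.addRight 1) ^ d.val * Φ (Units.mulLeft u) ^ i,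
      mul_mem (pow_mem (Subgroup.subset_closure (by simp)) _)
        (zpow_mem (Subgroup.subset_closure (by simp)) _), ?_, ?_⟩
    · rw [← map_pow, ← map_zpow, ← map_mul, hΦ, hpow, Equiv.Perm.mul_apply, hpowu]
      congr 2
      simp [d]
    · rw [← map_pow, ← map_zpow, ← map_mul, hΦ, hpow, Equiv.Perm.mul_apply, hpowu]
      congr 2
      simp only [ZMod.natCast_val, ZMod.cast_id', id_eq, Equiv.coe_addRight, d]
      field_simp
      ring

variable [Fintype V]

/-- The edges of the complete graph on the vertex set `R`. -/
def completeEdges (R : Finset V) : Finset (EdgeQuery V) :=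
  Finset.univ.filter fun e => ∀ x ∈ e.1, x ∈ R

/-- The edges joining `v` to the vertices of `R`. -/
def starEdges (v : V) (R : Finset V) : Finset (EdgeQuery V) :=
  (completeEdges R).filter fun e => v ∈ e.1

/-- The edges of the complete bipartite graph with parts `A` and `B`. -/
def bipartiteEdges (A B : Finset V) : Finset (EdgeQuery V) :=
  Finset.univ.filter fun e => ∃ a ∈ A, ∃ b ∈ B, e.1 = s(a, b)

theorem mem_completeEdges {R : Finset V} {e : EdgeQuery V} :
    e ∈ completeEdges R ↔ ∀ x ∈ e.1, x ∈ R := by simp [completeEdges]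

theorem mem_starEdges {v : V} {R : Finset V} {e : EdgeQuery V} :
    e ∈ starEdges v R ↔ (∀ x ∈ e.1, x ∈ R) ∧ v ∈ e.1 := by
  simp [starEdges, mem_completeEdges]

theorem mem_bipartiteEdges {A B : Finset V} {e : EdgeQuery V} :
    e ∈ bipartiteEdges A B ↔ ∃ a ∈ A, ∃ b ∈ B, e.1 = s(a, b) := by simp [bipartiteEdges]

theorem completeEdges_mono {R S : Finset V} (h : R ⊆ S) : completeEdges R ⊆ completeEdges S :=
  fun _ he => mem_completeEdges.2 fun x hx => h (mem_completeEdges.1 he x hx)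

theorem card_completeEdges (R : Finset V) : R.card.choose 2 ≤ (completeEdges R).card := by
  rw [← Fintype.card_coe R, ← Sym2.card_subtype_not_diag, ← Finset.card_univ]
  refine Finset.card_le_card_of_injOn (fun e => ⟨e.1.map Subtype.val, ?_⟩) ?_ ?_
  · exact fun h => e.2 ((Sym2.isDiag_map Subtype.val_injective).1 h)
  · rintro e -
    rw [Finset.mem_coe, mem_completeEdges]
    intro x hx
    obtain ⟨y, -, rfl⟩ := Sym2.mem_map.1 hx
    exact y.2
  · rintro e - e' - h
    exact Subtype.ext (Sym2.map.injective Subtype.val_injective (congrArg Subtype.val h))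

theorem card_bipartiteEdges {A B : Finset V} (hAB : Disjoint A B) :
    A.card * B.card ≤ (bipartiteEdges A B).card := by
  have hne : ∀ a ∈ A, ∀ b ∈ B, a ≠ b := fun a ha b hb h => Finset.disjoint_left.1 hAB ha (h ▸ hb)
  have hinj : Set.InjOn (fun q : V × V => s(q.1, q.2)) (A ×ˢ B : Finset (V × V)) := by
    rintro ⟨a, b⟩ h ⟨a', b'⟩ h' heq
    simp only [Finset.coe_product, Set.mem_prod, Finset.mem_coe] at h h'
    rcases Sym2.eq_iff.1 heq with ⟨h1, h2⟩ | ⟨h1, -⟩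
    · exact Prod.ext h1 h2
    · exact absurd h1 (hne _ h.1 _ h'.2)
  rw [← Finset.card_product, ← Finset.card_image_of_injOn hinj,
    ← Finset.card_map (Function.Embedding.subtype _) (s := bipartiteEdges A B)]
  refine Finset.card_le_card fun e he => ?_
  obtain ⟨⟨a, b⟩, hab, rfl⟩ := Finset.mem_image.1 he
  rw [Finset.mem_product] at hab
  exact Finset.mem_map.2 ⟨⟨s(a, b), by simpa using hne a hab.1 b hab.2⟩,
    mem_bipartiteEdges.2 ⟨a, hab.1, b, hab.2, rfl⟩, rfl⟩

theorem edgePerm_mem_completeEdges {R : Finset V} {σ : Equiv.Perm V} (hσ : ∀ x ∈ R, σ x ∈ R)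
    {e : EdgeQuery V} (he : e ∈ completeEdges R) : edgePerm σ e ∈ completeEdges R := by
  rw [mem_completeEdges] at he ⊢
  intro x hx
  obtain ⟨y, hy, rfl⟩ := Sym2.mem_map.1 hx
  exact hσ y (he y hy)

/-! ### Restricted graph properties -/

/-- The situation that remains after some vertices have been made isolated or dominating: `L` are
the edges answered "yes" so far, `R` are the vertices that are left, and the function on the graphs
on `R` that `f` and `L` define is a nontrivial graph property. -/
structure IsRestriction (f : Finset (EdgeQuery V) → Bool) (L : Finset (EdgeQuery V))
    (R : Finset V) : Prop where
  disjoint : Disjoint L (completeEdges R)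
  invariant : ∀ σ : Equiv.Perm V, (∀ x ∉ R, σ x = x) → ∀ e ∈ L, edgePerm σ e ∈ L
  eq_false : f L = false
  eq_true : f (L ∪ completeEdges R) = true

variable {f : Finset (EdgeQuery V) → Bool} {L : Finset (EdgeQuery V)} {R : Finset V}

theorem IsRestriction.isolate (h : IsRestriction f L R) {v : V}
    (hv : f (L ∪ completeEdges (R.erase v)) = true) : IsRestriction f L (R.erase v) where
  disjoint := h.disjoint.mono_right (completeEdges_mono (Finset.erase_subset v R))
  invariant σ hσ := h.invariant σ fun x hx => hσ x fun hx' => hx (Finset.mem_of_mem_erase hx')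
  eq_false := h.eq_false
  eq_true := hv

theorem IsRestriction.dominate (hf : Monotone f) (h : IsRestriction f L R) {v : V}
    (hv : f (L ∪ starEdges v R) = false) :
    IsRestriction f (L ∪ starEdges v R) (R.erase v) where
  disjoint := by
    refine Finset.disjoint_union_left.2
      ⟨h.disjoint.mono_right (completeEdges_mono (Finset.erase_subset v R)), ?_⟩
    refine Finset.disjoint_left.2 fun e he he' => ?_
    exact Finset.notMem_erase v R (mem_completeEdges.1 he' v (mem_starEdges.1 he).2)
  invariant σ hσ e he := by
    have hσR : ∀ x ∉ R, σ x = x := fun x hx => hσ x fun hx' => hx (Finset.mem_of_mem_erase hx')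
    rcases Finset.mem_union.1 he with he | he
    · exact Finset.mem_union_left _ (h.invariant σ hσR e he)
    · obtain ⟨h1, h2⟩ := mem_starEdges.1 he
      refine Finset.mem_union_right _ (mem_starEdges.2 ⟨mem_completeEdges.1
        (edgePerm_mem_completeEdges (fun x hx => apply_mem_of_fixes_compl hσR hx)
          (mem_completeEdges.2 h1)), Sym2.mem_map.2 ⟨v, h2, hσ v (Finset.notMem_erase v R)⟩⟩)
  eq_false := hv
  eq_true := by
    by_contra hne
    have h1 : L ∪ completeEdges R ⊆ L ∪ starEdges v R ∪ completeEdges (R.erase v) := by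
      intro e he
      by_cases hve : v ∈ e.1
      · refine Finset.mem_union_left _ ((Finset.mem_union.1 he).elim (Finset.mem_union_left _) ?_)
        exact fun he => Finset.mem_union_right _ (mem_starEdges.2 ⟨mem_completeEdges.1 he, hve⟩)
      · refine (Finset.mem_union.1 he).elim
          (fun he => Finset.mem_union_left _ (Finset.mem_union_left _ he)) fun he =>
            Finset.mem_union_right _ (mem_completeEdges.2 fun x hx =>
              Finset.mem_erase.2 ⟨fun hxv => hve (hxv ▸ hx), mem_completeEdges.1 he x hx⟩)
    have h2 := eq_false_of_subset hf h1 (by simpa using hne)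
    rw [h.eq_true] at h2
    exact Bool.noConfusion h2

/-- On a prime number of vertices a nontrivial monotone graph property is evasive, since the affine
group is transitive on the edges. -/
theorem IsRestriction.card_completeEdges_le (hf : Monotone f)
    (hinv : ∀ (σ : Equiv.Perm V) (Y), f ((edgePerm σ).finsetCongr Y) = f Y)
    (h : IsRestriction f L R) (hp : R.card.Prime) {t : DecisionTree (EdgeQuery V)}
    (ht : ∀ Y : Finset (EdgeQuery V), t.eval (fun e => decide (e ∈ Y)) = f Y) :
    (completeEdges R).card ≤ t.depth := by
  by_contra! hdepth
  obtain ⟨τ, g, j, hτ, hτg, hτR, hgR, htrans⟩ := exists_affine_perms hp rfl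
  have hC : ∀ σ : Equiv.Perm V, (∀ x ∉ R, σ x = x) →
      (edgePerm σ).finsetCongr (L ∪ completeEdges R) = L ∪ completeEdges R := fun σ hσ =>
    finsetCongr_eq_of_mapsTo fun e he => Finset.mem_union.2 <| (Finset.mem_union.1 he).imp
      (h.invariant σ hσ e) (edgePerm_mem_completeEdges fun x hx => apply_mem_of_fixes_compl hσ hx)
  obtain ⟨Y, hLY, hYC, hY, hYτ, hYg⟩ := exists_fixed_falseSet hf (B := L)
    (C := L ∪ completeEdges R) (t := t) Finset.subset_union_left
    (by rwa [Finset.union_sdiff_cancel_left h.disjoint]) (fun Y _ _ => ht Y) h.eq_false hp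
    (τ := edgePerm τ) (g := edgePerm g) (j := j)
    (by rw [← map_pow, hτ, map_one]) (by rw [← map_pow, ← map_mul, ← map_mul, hτg])
    (hinv τ) (finsetCongr_eq_of_mapsTo (h.invariant τ hτR)) (hC τ hτR)
    (hinv g) (finsetCongr_eq_of_mapsTo (h.invariant g hgR)) (hC g hgR)
  obtain ⟨e, heY, heL⟩ := Finset.exists_of_ssubset hLY
  have he := mem_completeEdges.1 ((Finset.mem_union.1 (hYC heY)).resolve_left heL)
  obtain ⟨x, y, hxy, hexy⟩ := exists_mk_eq e
  have hsub : L ∪ completeEdges R ⊆ Y := by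
    refine Finset.union_subset hLY.subset fun e' he' => ?_
    rw [mem_completeEdges] at he'
    obtain ⟨x', y', hxy', hexy'⟩ := exists_mk_eq e'
    obtain ⟨σ, hσ, hx, hy⟩ := htrans x (he x (by simp [hexy])) y (he y (by simp [hexy]))
      x' (he' x' (by simp [hexy'])) y' (he' y' (by simp [hexy'])) hxy hxy'
    have hmem := edgePerm_mem_of_mem_closure (S := {τ, g}) (Y := Y) (by
      rintro ρ (rfl | rfl)
      · exact hYτ
      · exact hYg) hσ heY
    have heq : edgePerm σ e = e' := Subtype.ext (by
      rw [coe_edgePerm_apply, hexy, hexy', Sym2.map_mk, hx, hy])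
    rwa [heq] at hmem
  have := eq_false_of_subset hf hsub hY
  rw [h.eq_true] at this
  exact Bool.noConfusion this

/-- If isolated vertices force the value "false" and dominating vertices the value "true", then the
restriction to the edges between `A` and `B`, with `A` made complete and `B` made empty, is evasive,
since no nonempty set of these edges at which `f` is false is invariant under a cyclic rotation
of `B`. -/
theorem IsRestriction.card_bipartiteEdges_le (hf : Monotone f)
    (hinv : ∀ (σ : Equiv.Perm V) (Y), f ((edgePerm σ).finsetCongr Y) = f Y)
    (h : IsRestriction f L R)
    (hisolate : ∀ v ∈ R, f (L ∪ completeEdges (R.erase v)) = false)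
    (hdominate : ∀ v ∈ R, f (L ∪ starEdges v R) = true)
    {A B : Finset V} (hAB : Disjoint A B) (hR : A ∪ B = R) (hB : B.Nonempty)
    {t : DecisionTree (EdgeQuery V)}
    (ht : ∀ Y : Finset (EdgeQuery V), t.eval (fun e => decide (e ∈ Y)) = f Y) :
    (bipartiteEdges A B).card ≤ t.depth := by
  by_contra! hdepth
  have hAR : A ⊆ R := hR ▸ Finset.subset_union_left
  have hBR : B ⊆ R := hR ▸ Finset.subset_union_right
  obtain ⟨g, hgB, hgsupp⟩ := B.exists_cycleOn
  have hgfix : ∀ x ∉ B, g x = x := fun x hx =>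
    Equiv.Perm.notMem_support.1 fun hx' => hx (hgsupp hx')
  have hgfixA : ∀ x ∈ A, g x = x := fun x hx => hgfix x (Finset.disjoint_left.1 hAB hx)
  have hgmem : ∀ x ∈ B, g x ∈ B := fun x hx => apply_mem_of_fixes_compl hgfix hx
  have hLg : ∀ e ∈ L ∪ completeEdges A, edgePerm g e ∈ L ∪ completeEdges A := fun e he =>
    Finset.mem_union.2 <| (Finset.mem_union.1 he).imp
      (h.invariant g (fun x hx => hgfix x fun hx' => hx (hBR hx')) e)
      (edgePerm_mem_completeEdges fun x hx => by rwa [hgfixA x hx])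
  have hCg : ∀ e ∈ L ∪ completeEdges A ∪ bipartiteEdges A B,
      edgePerm g e ∈ L ∪ completeEdges A ∪ bipartiteEdges A B := fun e he =>
    Finset.mem_union.2 <| (Finset.mem_union.1 he).imp (hLg e) fun he => by
      obtain ⟨a, ha, b, hb, hab⟩ := mem_bipartiteEdges.1 he
      exact mem_bipartiteEdges.2 ⟨a, ha, g b, hgmem b hb, by
        rw [coe_edgePerm_apply, hab, Sym2.map_mk, hgfixA a ha]⟩
  have hdisj : Disjoint (L ∪ completeEdges A) (bipartiteEdges A B) := by
    refine Finset.disjoint_right.2 fun e he he' => ?_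
    obtain ⟨a, ha, b, hb, hab⟩ := mem_bipartiteEdges.1 he
    rcases Finset.mem_union.1 he' with he' | he'
    · refine Finset.disjoint_left.1 h.disjoint he' (mem_completeEdges.2 fun x hx => ?_)
      rw [hab, Sym2.mem_iff] at hx
      rcases hx with rfl | rfl
      · exact hAR ha
      · exact hBR hb
    · exact Finset.disjoint_right.1 hAB hb (mem_completeEdges.1 he' b (by simp [hab]))
  have hlow : f (L ∪ completeEdges A) = false := by
    obtain ⟨b, hb⟩ := hB
    refine eq_false_of_subset hf (Finset.union_subset_union_right (completeEdges_mono ?_))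
      (hisolate b (hBR hb))
    exact Finset.subset_erase.2 ⟨hAR, Finset.disjoint_right.1 hAB hb⟩
  -- Only the rotation `g` is needed, so the permutation of prime order is trivial.
  obtain ⟨Y, hLY, hYC, hY, -, hYg⟩ := exists_fixed_falseSet hf (t := t)
    (B := L ∪ completeEdges A) (C := L ∪ completeEdges A ∪ bipartiteEdges A B)
    Finset.subset_union_left
    (by rwa [Finset.union_sdiff_cancel_left hdisj]) (fun Y _ _ => ht Y) hlow Nat.prime_two
    (τ := edgePerm 1) (g := edgePerm g) (j := 1) (by simp) (by simp)
    (hinv 1) (finsetCongr_eq_of_mapsTo (by simp)) (finsetCongr_eq_of_mapsTo (by simp))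
    (hinv g) (finsetCongr_eq_of_mapsTo hLg) (finsetCongr_eq_of_mapsTo hCg)
  obtain ⟨e, heY, heL⟩ := Finset.exists_of_ssubset hLY
  obtain ⟨a, ha, b, hb, hab⟩ :=
    mem_bipartiteEdges.1 ((Finset.mem_union.1 (hYC heY)).resolve_left heL)
  have hsub : L ∪ starEdges a R ⊆ Y := by
    refine Finset.union_subset (Finset.subset_union_left.trans hLY.subset) fun e' he' => ?_
    obtain ⟨h1, h2⟩ := mem_starEdges.1 he'
    obtain ⟨c, hc⟩ := Sym2.mem_iff_exists.1 h2
    have hcR : c ∈ A ∪ B := hR ▸ h1 c (by simp [hc])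
    rcases Finset.mem_union.1 hcR with hcA | hcB
    · refine hLY.subset (Finset.mem_union_right _ (mem_completeEdges.2 fun x hx => ?_))
      rw [hc, Sym2.mem_iff] at hx
      rcases hx with rfl | rfl
      · exact ha
      · exact hcA
    · obtain ⟨i, hi⟩ := hgB.2 hb hcB
      have hmem := edgePerm_mem_of_mem_closure (S := {g}) (Y := Y) (by
        rintro ρ rfl
        exact hYg) (zpow_mem (Subgroup.subset_closure (Set.mem_singleton g)) i) heY
      have heq : edgePerm (g ^ i) e = e' := Subtype.ext (by
        rw [coe_edgePerm_apply, hab, hc, Sym2.map_mk, hi,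
          Function.IsFixedPt.perm_zpow (hgfixA a ha) i])
      rwa [heq] at hmem
  have := eq_false_of_subset hf hsub hY
  rw [hdominate a (hAR ha)] at this
  exact Bool.noConfusion this

theorem IsRestriction.sq_le_four_mul_depth (hf : Monotone f)
    (hinv : ∀ (σ : Equiv.Perm V) (Y), f ((edgePerm σ).finsetCongr Y) = f Y)
    {t : DecisionTree (EdgeQuery V)}
    (ht : ∀ Y : Finset (EdgeQuery V), t.eval (fun e => decide (e ∈ Y)) = f Y)
    {p : ℕ} (hp : p.Prime) : ∀ (n : ℕ) (L : Finset (EdgeQuery V)) (R : Finset V),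
      R.card = p + n → IsRestriction f L R → p ^ 2 ≤ 4 * t.depth := by
  intro n
  induction n with
  | zero =>
    intro L R hR h
    rw [add_zero] at hR
    have h1 := h.card_completeEdges_le hf hinv (hR ▸ hp) ht
    have h2 := card_completeEdges R
    rw [hR, Nat.choose_two_right] at h2
    have h3 : p * (p - 1) / 2 * 2 = p * (p - 1) :=
      Nat.div_mul_cancel (Nat.even_mul_pred_self p).two_dvd
    obtain ⟨q, rfl⟩ : ∃ q, p = q + 2 := ⟨p - 2, by have := hp.two_le; omega⟩
    simp only [Nat.add_succ_sub_one] at h2 h3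
    nlinarith
  | succ n ih =>
    intro L R hR h
    have hcard : ∀ v ∈ R, (R.erase v).card = p + n := fun v hv => by
      rw [Finset.card_erase_of_mem hv]; omega
    by_cases h1 : ∃ v ∈ R, f (L ∪ completeEdges (R.erase v)) = true
    · obtain ⟨v, hv, hfv⟩ := h1
      exact ih L _ (hcard v hv) (h.isolate hfv)
    by_cases h2 : ∃ v ∈ R, f (L ∪ starEdges v R) = false
    · obtain ⟨v, hv, hfv⟩ := h2
      exact ih _ _ (hcard v hv) (h.dominate hf hfv)
    push Not at h1 h2
    obtain ⟨A, hAR, hA⟩ := Finset.exists_subset_card_eq (s := R) (n := R.card / 2) (by omega)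
    have hB : (R \ A).card = R.card - R.card / 2 := by rw [Finset.card_sdiff_of_subset hAR, hA]
    have h3 := h.card_bipartiteEdges_le hf hinv (fun v hv => by simpa using h1 v hv)
      (fun v hv => by simpa using h2 v hv) (A := A) (B := R \ A) Finset.disjoint_sdiff
      (Finset.union_sdiff_of_subset hAR)
      (Finset.card_pos.1 (by rw [hB]; have := hp.two_le; omega)) ht
    have h4 := card_bipartiteEdges (A := A) (B := R \ A) Finset.disjoint_sdiff
    rw [hA, hB] at h4
    generalize R.card = m at *
    obtain ⟨c, rfl | rfl⟩ := Nat.even_or_odd' m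
    · have e1 : 2 * c / 2 = c := by omega
      have e2 : 2 * c - c = c := by omega
      rw [e1, e2] at h4
      nlinarith
    · have e1 : (2 * c + 1) / 2 = c := by omega
      have e2 : 2 * c + 1 - c = c + 1 := by omega
      rw [e1, e2] at h4
      nlinarith

end Graphs

theorem mainTheorem4 {V : Type*} [Fintype V] (h : SimpleGraph V → Bool)
    (hprop : IsGraphProperty h) (hmono : Monotone h) (hnontriv : IsNontrivialGraphFunction h)
    (p : ℕ) (hp : IsGreatest {q : ℕ | q.Prime ∧ q ≤ Fintype.card V} p) :
    (p : ℝ) ^ 2 / 4 ≤ (decisionTreeComplexity h : ℝ) := by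
  classical
  obtain ⟨hprime, hple⟩ := hp.1
  obtain ⟨t, ht, hdepth⟩ : ∃ t : DecisionTree (EdgeQuery V), ComputesGraphFunction t h ∧
      t.depth = decisionTreeComplexity h := by
    obtain ⟨t, ht⟩ := exists_computesGraphFunction h
    exact Nat.sInf_mem (s := {d : ℕ | ∃ t : DecisionTree (EdgeQuery V),
      ComputesGraphFunction t h ∧ t.depth = d}) ⟨_, t, ht, rfl⟩
  have hbot : h ⊥ = false ∧ h ⊤ = true := by
    obtain ⟨G, G', hG⟩ := hnontriv
    have h1 := hmono (bot_le : ⊥ ≤ G)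
    have h2 := hmono (bot_le : ⊥ ≤ G')
    have h3 := hmono (le_top : G ≤ ⊤)
    have h4 := hmono (le_top : G' ≤ ⊤)
    revert hG h1 h2 h3 h4
    cases h G <;> cases h G' <;> cases h ⊥ <;> cases h ⊤ <;> decide
  have hR : IsRestriction (fun Y => h (graphOfEdges Y)) ∅ (Finset.univ : Finset V) :=
    { disjoint := Finset.disjoint_empty_left _
      invariant := by simp
      eq_false := by
        have : graphOfEdges (∅ : Finset (EdgeQuery V)) = ⊥ := by simp [graphOfEdges]
        rw [this, hbot.1]
      eq_true := by
        have : graphOfEdges (∅ ∪ completeEdges (Finset.univ : Finset V)) = ⊤ := by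
          refine top_le_iff.1 fun x y hxy => ?_
          rw [← SimpleGraph.mem_edgeSet]
          exact (mem_edgeSet_graphOfEdges _ ⟨s(x, y), by simpa using hxy⟩).2
            (Finset.mem_union_right _ (mem_completeEdges.2 fun _ _ => Finset.mem_univ _))
        rw [this, hbot.2] }
  have key := IsRestriction.sq_le_four_mul_depth (hmono.comp monotone_graphOfEdges)
    (fun σ Y => (hprop _ _ (graphOfEdges_iso σ Y)).symm) (t := t)
    (fun Y => by rw [← edgeAnswers_graphOfEdges]; exact ht _) hprime
    (Fintype.card V - p) ∅ Finset.univ (by rw [Finset.card_univ]; omega) hR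
  rw [← hdepth, div_le_iff₀ (by norm_num)]
  have : (p : ℝ) ^ 2 ≤ 4 * t.depth := by exact_mod_cast key
  linarith
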